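/- Let $n,p\ge 0$ be integers, let $M$ be a connected smooth manifold (Hausdorff, second countable, without boundary) of dimension $2n+1$, and let $\mathcal H\subset TM$ be a contact distribution: every point of $M$ has an open neighbourhood $U$ with a smooth contact form $\alpha_U$ on $U$ (that is, $\alpha_U\wedge(d\alpha_U)^n\neq 0$ everywhere; equivalently, $\alpha_U$ is nowhere zero and $d\alpha_U$ is nondegenerate on $\ker\alpha_U$) such that $\mathcal H|_U=\ker\alpha_U$. An infinitesimal automorphism of $\mathcal H$ is a smooth vector field $X$ such that, for every local contact form $\alpha_U$ defining $\mathcal H$, $\mathcal L_X\alpha_U=\lambda\alpha_U$ for some smooth function $\lambda$ on $U$. Let $\pi:M\to W$ be a proper submersion to a smooth manifold $W$ (Hausdorff, second countable) of dimension $p\ge n$, put $\mathcal F=\ker\pi_*$, and let $\mathcal X$ be a real vector space of smooth vector fields on $M$. Assume that $(M,\mathcal H,\mathcal X)$ is a complete pre-isotropic contact structure related to $\pi$, that is: (i) $\mathcal F$ is pre-isotropic: $\mathcal F_x+\mathcal H_x=T_xM$ for all $x\in M$, and $\mathcal G=\mathcal F\cap\mathcal H$ is isotropic in $\mathcal H$,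 i.e. $d\alpha_U$ vanishes on $\mathcal G_x\times\mathcal G_x$ for every local contact form $\alpha_U$ defining $\mathcal H$ near $x$; (ii) $\mathcal X$ is an Abelian Lie algebra ($[X,Y]=0$ for all $X,Y\in\mathcal X$) of infinitesimal automorphisms of $\mathcal H$ which has the fibers of $\pi$ as orbits: for every $x\in M$, the set of points reached from $x$ along finitely many successive integral curves of elements of $\mathcal X$ is the connected component of $x$ in the fiber $\pi^{-1}(\pi(x))$ (hence the whole fiber, if the fibers are connected). Assume moreover that $\mathcal H$ is co-oriented, i.e. the line bundle $TM/\mathcal H$ is oriented. Then there is a smooth contact form $\alpha$ defined on all of $M$ with $\ker\alpha=\mathcal H$ which is invariant under all elements of $\mathcal X$: $\mathcal L_X\alpha=0$ for every $X\in\mathcal X$. -/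

import Mathlib

open Set
open scoped Manifold ContDiff Topology

noncomputable section

namespace PreIsotropic

section Forms

variable {m : ℕ} {M : Type*} [TopologicalSpace M] [ChartedSpace (EuclideanSpace ℝ (Fin m)) M]

/-- A (not necessarily smooth) vector field on `M`. -/
abbrev VField (m : ℕ) (M : Type*) [TopologicalSpace M]
    [ChartedSpace (EuclideanSpace ℝ (Fin m)) M] : Type _ :=
  (x : M) → TangentSpace (𝓡 m) x

/-- A (not necessarily smooth) Pfaffian form (1-form) on `M`. -/
abbrev OneForm (m : ℕ) (M : Type*) [TopologicalSpace M]
    [ChartedSpace (EuclideanSpace ℝ (Fin m)) M] : Type _ :=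
  (x : M) → (TangentSpace (𝓡 m) x →L[ℝ] ℝ)

/-- A field of tangent subspaces on `M`. -/
abbrev Distribution (m : ℕ) (M : Type*) [TopologicalSpace M]
    [ChartedSpace (EuclideanSpace ℝ (Fin m)) M] : Type _ :=
  (x : M) → Submodule ℝ (TangentSpace (𝓡 m) x)

/-- Smooth vector fields: smooth sections of the tangent bundle. -/
def SmoothVField [IsManifold (𝓡 m) ∞ M] (X : VField m M) : Prop :=
  ContMDiff (𝓡 m) (𝓡 m).tangent ∞ (fun x => (⟨x, X x⟩ : TangentBundle (𝓡 m) M))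

/-- `α` is smooth on `U`, as a section of the cotangent bundle. -/
def SmoothFormOn [IsManifold (𝓡 m) ∞ M] (U : Set M) (α : OneForm m M) : Prop :=
  ContMDiffOn (𝓡 m) ((𝓡 m).prod 𝓘(ℝ, EuclideanSpace ℝ (Fin m) →L[ℝ] ℝ)) ∞
    (fun x => Bundle.TotalSpace.mk' (EuclideanSpace ℝ (Fin m) →L[ℝ] ℝ)
      (E := fun x : M => TangentSpace (𝓡 m) x →L[ℝ] Bundle.Trivial M ℝ x) x (α x)) U

/-- The coordinate expression of `α` in the chart around `x₀`: its pullback under the inverse of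
that chart. -/
def inChart (α : OneForm m M) (x₀ : M) (y : EuclideanSpace ℝ (Fin m)) :
    EuclideanSpace ℝ (Fin m) →L[ℝ] ℝ :=
  (α ((extChartAt (𝓡 m) x₀).symm y)).comp
    (mfderiv 𝓘(ℝ, EuclideanSpace ℝ (Fin m)) (𝓡 m) (extChartAt (𝓡 m) x₀).symm y)

/-- The exterior derivative of a 1-form at the point `x`, as a map of two tangent vectors:
`dα(u, v) = (∂_u α)(v) - (∂_v α)(u)`, computed in the chart around `x`. -/
def extD (α : OneForm m M) (x : M) (u v : TangentSpace (𝓡 m) x) : ℝ :=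
  let D : TangentSpace (𝓡 m) x →L[ℝ] EuclideanSpace ℝ (Fin m) :=
    mfderiv (𝓡 m) 𝓘(ℝ, EuclideanSpace ℝ (Fin m)) (extChartAt (𝓡 m) x) x
  let A : EuclideanSpace ℝ (Fin m) →L[ℝ] EuclideanSpace ℝ (Fin m) →L[ℝ] ℝ :=
    fderiv ℝ (inChart α x) (extChartAt (𝓡 m) x x)
  A (D u) (D v) - A (D v) (D u)

/-- The Lie derivative of a 1-form along a vector field, `L_X α = i_X dα + d(i_X α)`. -/
def lieD (X : VField m M) (α : OneForm m M) (x : M) (v : TangentSpace (𝓡 m) x) : ℝ :=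
  let df : TangentSpace (𝓡 m) x →L[ℝ] ℝ := mfderiv (𝓡 m) 𝓘(ℝ, ℝ) (fun y => α y (X y)) x
  extD α x (X x) v + df v

end Forms

section Contact

variable {m : ℕ} {M : Type*} [TopologicalSpace M] [ChartedSpace (EuclideanSpace ℝ (Fin m)) M]
  [IsManifold (𝓡 m) ∞ M]

/-- `α` is a contact form on the open set `U`: it is smooth and nowhere zero on `U`, and `dα` is
nondegenerate on `ker α`. In dimension `2 n + 1` this says that `α ∧ (dα)ⁿ` vanishes nowhere. -/
structure IsContactFormOn (U : Set M) (α : OneForm m M) : Prop where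
  isOpen : IsOpen U
  smooth : SmoothFormOn U α
  ne_zero : ∀ x ∈ U, α x ≠ 0
  nondegenerate : ∀ x ∈ U, ∀ u : TangentSpace (𝓡 m) x, α x u = 0 →
    (∀ v : TangentSpace (𝓡 m) x, α x v = 0 → extD α x u v = 0) → u = 0

/-- `α` is a contact form on the open set `U` that defines `ξ` there: `ξ = ker α` on `U`. -/
structure Represents (ξ : Distribution m M) (U : Set M) (α : OneForm m M) : Prop where
  contact : IsContactFormOn U α
  mem_iff : ∀ x ∈ U, ∀ v : TangentSpace (𝓡 m) x, v ∈ ξ x ↔ α x v = 0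

/-- `ξ` is a contact distribution: locally it is the kernel of a contact form. -/
def IsContactDistribution (ξ : Distribution m M) : Prop :=
  ∀ x : M, ∃ U : Set M, x ∈ U ∧ ∃ α : OneForm m M, Represents ξ U α

/-- `P` is a co-orientation of `ξ`, i.e. an orientation of the line bundle `TM / ξ`: `P x` is the
set of positively transverse vectors at `x`, one of the two sides of `ξ x`, and it depends
continuously on `x`. -/
def IsCoorientation (ξ : Distribution m M) (P : (x : M) → Set (TangentSpace (𝓡 m) x)) : Prop :=
  ∀ x : M, ∃ U : Set M, x ∈ U ∧ ∃ α : OneForm m M, Represents ξ U α ∧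
    ∀ y ∈ U, P y = {v | 0 < α y v}

/-- `X` is an infinitesimal automorphism of the contact structure `ξ` (a contact vector field):
for every local contact form `α` defining `ξ`, one has `L_X α = λ α` with `λ` smooth. -/
structure IsContactVField (ξ : Distribution m M) (X : VField m M) : Prop where
  smooth : SmoothVField X
  lie_eq : ∀ (U : Set M) (α : OneForm m M), Represents ξ U α →
    ∃ c : M → ℝ, ContMDiffOn (𝓡 m) 𝓘(ℝ, ℝ) ∞ c U ∧
      ∀ x ∈ U, ∀ v : TangentSpace (𝓡 m) x, lieD X α x v = c x * α x v

/-- A subspace `V` of `ξ x` is isotropic for the conformal class of `dα` on `ξ x`, where `α` is a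
local contact form defining `ξ`. -/
def IsIsotropicAt (ξ : Distribution m M) (x : M) (V : Submodule ℝ (TangentSpace (𝓡 m) x)) :
    Prop :=
  V ≤ ξ x ∧ ∀ (U : Set M) (α : OneForm m M), x ∈ U → Represents ξ U α →
    ∀ u ∈ V, ∀ v ∈ V, extD α x u v = 0

/-- The orbit of `x` under a space `𝒳` of vector fields: the points that are reached from `x` along
finitely many successive integral curves of elements of `𝒳`. -/
def orbit (𝒳 : Submodule ℝ (VField m M)) (x : M) : Set M :=
  {y | Relation.ReflTransGen
    (fun a b : M => ∃ X ∈ 𝒳, ∃ γ : ℝ → M,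
      IsMIntegralCurveOn (I := 𝓡 m) γ X (Icc 0 1) ∧ γ 0 = a ∧ γ 1 = b) x y}

/-- The vertical distribution `𝓕 = ker π_*` of a map `π : M → W`. -/
def vertical {p : ℕ} {W : Type*} [TopologicalSpace W]
    [ChartedSpace (EuclideanSpace ℝ (Fin p)) W] (π : M → W) : Distribution m M :=
  fun x => (mfderiv (𝓡 m) (𝓡 p) π x).ker

end Contact

/-- `(M, ξ, 𝒳)` is a complete pre-isotropic contact structure, related to the proper submersion
`π : M → W`, where `dim M = 2 n + 1` and `dim W = p ≥ n`.

The fibers of `π` need not be connected, while orbits always are; "the fibers are the orbits" means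
that the orbit of `x` is the connected component of `x` in its fiber (hence the whole fiber if the
fibers are connected). -/
structure IsCompletePreIsotropic {n p : ℕ}
    {M : Type*} [TopologicalSpace M] [ChartedSpace (EuclideanSpace ℝ (Fin (2 * n + 1))) M]
    [IsManifold (𝓡 (2 * n + 1)) ∞ M]
    {W : Type*} [TopologicalSpace W] [ChartedSpace (EuclideanSpace ℝ (Fin p)) W]
    (ξ : Distribution (2 * n + 1) M) (𝒳 : Submodule ℝ (VField (2 * n + 1) M))
    (π : M → W) : Prop where
  contact : IsContactDistribution ξ
  dim_le : n ≤ p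
  submersion : Manifold.IsSubmersion (𝓡 (2 * n + 1)) (𝓡 p) ∞ π
  proper : IsProperMap π
  /-- `𝓕 = ker π_*` is transversal to `ξ`. -/
  transversal : ∀ x : M, vertical (p := p) π x ⊔ ξ x = ⊤
  /-- `𝓖 = 𝓕 ∩ ξ` is isotropic. -/
  isotropic : ∀ x : M, IsIsotropicAt ξ x (vertical (p := p) π x ⊓ ξ x)
  /-- The elements of `𝒳` are infinitesimal automorphisms of `ξ`. -/
  contact_vfield : ∀ X ∈ 𝒳, IsContactVField ξ X
  /-- `𝒳` is an Abelian Lie algebra. -/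
  abelian : ∀ X ∈ 𝒳, ∀ Y ∈ 𝒳, VectorField.mlieBracket (𝓡 (2 * n + 1)) X Y = 0
  /-- The orbits of `𝒳` are the (connected components of the) fibers of `π`. -/
  orbit_eq : ∀ x : M, orbit 𝒳 x = connectedComponentIn (π ⁻¹' {π x}) x

end PreIsotropic

end

noncomputable section

namespace PreIsotropic

/-! ### Gronwall estimates for commuting vector fields on a normed space. -/

section Gronwall

open Metric

/-! Locally the invariant form is a normalisation. If `X ∈ 𝒳` is transversal to `ξ` and `α(X) = 1`,
then for `Y ∈ 𝒳` the relation `L_Y α = c α`, evaluated on `X`, gives `c = (L_Y α)(X) = Y(α(X)) = 0`,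
because `X` and `Y` commute (`Represents.normalize`).

The existence of a transversal `X` rests on `exists_apply_eq`: the values of `𝒳` at `x` fill the
vertical space. The orbit hypothesis says this only indirectly. Fibers are compact, so the fields
are complete. If the values `X i x` form a basis of the span at `x`, the map `Φ t = exp (∑ t i • X
i) x` has differential given by the fields `X i`. A field of `𝒳` vanishing at `x` vanishes along the
range of `Φ`, so every `Y ∈ 𝒳` agrees there with a constant combination of the `X i`, and the range
contains the orbit. Thus a component of the fiber is covered by a differentiable image of `ℝ^k`,
with `k` the dimension of the span; such an image cannot contain an open piece of a manifold of
larger dimension. The differential of `Φ` is computed directly by a second-order Gronwall estimate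
(`norm_sub_sub_smul_le_of_commute`).

Cut-off functions on `M` need not be constant along orbits, so the local forms are not averaged.
Instead, with a partition of unity `ρ` on `W` and finite sets `I w` of elements of `𝒳`, put `Q(β) =
∑ ρ_w(π) ∑_{X ∈ I w} β(X)²`. It is homogeneous of degree 2, so `β / √Q(β)` does not depend on the
positive form `β`; the co-orientation removes the sign ambiguity. For an invariant `β` all terms of
`Q(β)` are constant along `𝒳`, hence the quotient is invariant too. -/

/-- The Gronwall bound is linear in the initial error and the defect, so over times at most 1 a
single constant depending on `K` alone serves every estimate below. -/
theorem gronwallBound_le_add_mul {δ K ε x : ℝ} (hδ : 0 ≤ δ) (hε : 0 ≤ ε) (hK : 0 ≤ K)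
    (hx : x ≤ 1) : gronwallBound δ K ε x ≤ (δ + ε) * gronwallBound 1 K 1 1 := by
  refine (gronwallBound_mono hδ hε hK hx).trans ?_
  rcases hK.eq_or_lt with rfl | hK'
  · simp only [gronwallBound_K0]; nlinarith
  · simp only [gronwallBound_of_K_ne_0 hK'.ne']
    have h1 : 0 ≤ Real.exp (K * 1) - 1 := by
      have := Real.add_one_le_exp (K * 1); linarith
    have h2 : 0 ≤ (Real.exp (K * 1) - 1) / K := by positivity
    have h3 := (Real.exp_pos (K * 1)).le
    have : ε / K * (Real.exp (K * 1) - 1) = ε * ((Real.exp (K * 1) - 1) / K) := by ring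
    have h4 : 1 / K * (Real.exp (K * 1) - 1) = (Real.exp (K * 1) - 1) / K := by ring
    rw [this, h4]
    nlinarith [mul_nonneg hδ h2, mul_nonneg hε h3]

theorem one_le_gronwallBound_one {K : ℝ} (hK : 0 ≤ K) : 1 ≤ gronwallBound 1 K 1 1 := by
  have := gronwallBound_mono (δ := 1) (ε := 1) zero_le_one zero_le_one hK
    (zero_le_one : (0 : ℝ) ≤ 1)
  rwa [gronwallBound_x0] at this

variable {V : Type*} [NormedAddCommGroup V] [NormedSpace ℝ V]

/-- Bounds for a smooth vector field on a compact convex set. -/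
theorem exists_bound_of_contDiffOn {T B : Set V} (hT : IsOpen T) (hB : IsCompact B)
    (hc : Convex ℝ B) (hBT : B ⊆ T) {f : V → V} (hf : ContDiffOn ℝ ∞ f T) :
    ∃ K : ℝ, 0 ≤ K ∧ (∀ z ∈ B, ‖f z‖ ≤ K) ∧ (∀ z ∈ B, ‖fderiv ℝ f z‖ ≤ K) ∧
      (∀ z ∈ B, ∀ z' ∈ B, ‖f z' - f z‖ ≤ K * ‖z' - z‖) ∧
      (∀ z ∈ B, ∀ z' ∈ B, ‖f z' - f z - fderiv ℝ f z (z' - z)‖ ≤ K * ‖z' - z‖ ^ 2) := by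
  have hf1 : ContDiffOn ℝ ∞ (fderiv ℝ f) T := hf.fderiv_of_isOpen hT (by simp)
  have hf2 : ContDiffOn ℝ ∞ (fderiv ℝ (fderiv ℝ f)) T := hf1.fderiv_of_isOpen hT (by simp)
  obtain ⟨K0, h0⟩ := hB.exists_bound_of_continuousOn (hf.continuousOn.mono hBT)
  obtain ⟨K1, h1⟩ := hB.exists_bound_of_continuousOn (hf1.continuousOn.mono hBT)
  obtain ⟨K2, h2⟩ := hB.exists_bound_of_continuousOn (hf2.continuousOn.mono hBT)
  have hd : ∀ z ∈ B, DifferentiableAt ℝ f z := fun z hz =>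
    (hf.contDiffAt (hT.mem_nhds (hBT hz))).differentiableAt (by simp)
  have hd1 : ∀ z ∈ B, DifferentiableAt ℝ (fderiv ℝ f) z := fun z hz =>
    (hf1.contDiffAt (hT.mem_nhds (hBT hz))).differentiableAt (by simp)
  refine ⟨max 0 (max K0 (max K1 K2)), le_max_left _ _, fun z hz => (h0 z hz).trans (by simp),
    fun z hz => (h1 z hz).trans (by simp), fun z hz z' hz' => ?_, fun z hz z' hz' => ?_⟩
  · exact hc.norm_image_sub_le_of_norm_fderiv_le hd (fun w hw => (h1 w hw).trans (by simp)) hz hz'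
  -- On this smaller convex set `fderiv ℝ f` differs from its value at `z` by at most a multiple of
  -- `‖z' - z‖`; the mean value inequality supplies the second factor.
  · have hc' : Convex ℝ (B ∩ closedBall z ‖z' - z‖) := hc.inter (convex_closedBall _ _)
    have key := hc'.norm_image_sub_le_of_norm_fderiv_le' (φ := fderiv ℝ f z) (𝕜 := ℝ) (f := f)
      (C := max 0 (max K0 (max K1 K2)) * ‖z' - z‖) (x := z) (y := z')
      (fun w hw => hd w hw.1) (fun w hw => ?_) ⟨hz, by simp⟩ ⟨hz', by simp [dist_eq_norm]⟩
    · rw [pow_two, ← mul_assoc]; exact key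
    · refine (hc.norm_image_sub_le_of_norm_fderiv_le (𝕜 := ℝ) hd1
        (C := max 0 (max K0 (max K1 K2))) (fun u hu => (h2 u hu).trans (by simp)) hz hw.1).trans ?_
      have := hw.2
      rw [mem_closedBall, dist_eq_norm] at this
      gcongr

/-- Second-order comparison of an integral curve of `f` with one of `f + g`, when `f` and `g`
commute. -/
theorem norm_sub_sub_smul_le_of_commute {B : Set V} {f g : V → V} {K κ δ η v₀ v₁ : ℝ}
    {a b : ℝ → V} (hK : 0 ≤ K) (hκ : 0 ≤ κ)
    (hfd : ∀ z ∈ B, ‖fderiv ℝ f z‖ ≤ K)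
    (hfl : ∀ z ∈ B, ∀ z' ∈ B, ‖f z' - f z‖ ≤ K * ‖z' - z‖)
    (hfq : ∀ z ∈ B, ∀ z' ∈ B, ‖f z' - f z - fderiv ℝ f z (z' - z)‖ ≤ K * ‖z' - z‖ ^ 2)
    (hg : ∀ z ∈ B, DifferentiableAt ℝ g z)
    (hgb : ∀ z ∈ B, ‖g z‖ ≤ κ)
    (hgl : ∀ z ∈ B, ∀ z' ∈ B, ‖g z' - g z‖ ≤ κ * ‖z' - z‖)
    (hfg : ∀ z ∈ B, fderiv ℝ f z (g z) = fderiv ℝ g z (f z))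
    (hv : v₀ ≤ v₁) (hv1 : v₁ - v₀ ≤ 1)
    (ha : ∀ v ∈ Icc v₀ v₁, HasDerivAt a (f (a v)) v) (haB : ∀ v ∈ Icc v₀ v₁, a v ∈ B)
    (hb : ∀ v ∈ Icc v₀ v₁, HasDerivAt b (f (b v) + g (b v)) v) (hbB : ∀ v ∈ Icc v₀ v₁, b v ∈ B)
    (hδ : ‖b v₀ - a v₀‖ ≤ δ) (hη : ‖b v₀ - a v₀ - v₀ • g (a v₀)‖ ≤ η) :
    ‖b v₁ - a v₁ - v₁ • g (a v₁)‖ ≤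
      (η + (K + 1) * (gronwallBound 1 K 1 1 * (δ + κ)) ^ 2) * gronwallBound 1 K 1 1 := by
  set C := gronwallBound 1 K 1 1 with hC
  have hC1 : 1 ≤ C := one_le_gronwallBound_one hK
  have hδ0 : 0 ≤ δ := (norm_nonneg _).trans hδ
  have hη0 : 0 ≤ η := (norm_nonneg _).trans hη
  -- First-order estimate: `b` solves the equation of `a` up to the defect `g`, of size at most `κ`.
  have h1 : ∀ v ∈ Icc v₀ v₁, ‖b v - a v‖ ≤ C * (δ + κ) := by
    intro v hvI
    have := norm_le_gronwallBound_of_norm_deriv_right_le (f := fun v => b v - a v)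
      (f' := fun v => f (b v) + g (b v) - f (a v)) (δ := δ) (K := K) (ε := κ) (a := v₀) (b := v₁)
      (fun u hu => ((hb u hu).continuousAt.sub (ha u hu).continuousAt).continuousWithinAt)
      (fun u hu => ((hb u (Ico_subset_Icc_self hu)).sub
        (ha u (Ico_subset_Icc_self hu))).hasDerivWithinAt) hδ
      (fun u hu => ?_) v hvI
    · refine this.trans ?_
      rw [mul_comm]
      exact gronwallBound_le_add_mul hδ0 hκ hK (by linarith [hvI.2])
    · have hu' := Ico_subset_Icc_self hu
      calc ‖f (b u) + g (b u) - f (a u)‖ = ‖(f (b u) - f (a u)) + g (b u)‖ := by congr 1; abel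
        _ ≤ _ := norm_add_le_of_le (hfl _ (haB u hu') _ (hbB u hu')) (hgb _ (hbB u hu'))
  -- Since `f` and `g` commute, `v • g (a v)` solves the linearised equation `w' = Df(a) w + g(a)`.
  -- Apart from the linear term, only errors quadratic in `δ + κ` remain.
  have hder : ∀ u ∈ Icc v₀ v₁, HasDerivAt (fun v => b v - a v - v • g (a v))
      ((f (b u) - f (a u) - fderiv ℝ f (a u) (b u - a u)) +
        fderiv ℝ f (a u) (b u - a u - u • g (a u)) + (g (b u) - g (a u))) u := by
    intro u hu
    have hga : HasDerivAt (fun v => g (a v)) (fderiv ℝ g (a u) (f (a u))) u :=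
      (hg _ (haB u hu)).hasFDerivAt.comp_hasDerivAt u (ha u hu)
    have := ((hb u hu).sub (ha u hu)).sub ((hasDerivAt_id u).smul hga)
    refine this.congr_deriv ?_
    simp only [map_sub, map_smul, hfg _ (haB u hu), id, one_smul]
    abel
  have := norm_le_gronwallBound_of_norm_deriv_right_le
      (δ := η) (K := K) (ε := (K + 1) * (C * (δ + κ)) ^ 2) (a := v₀) (b := v₁)
      (fun u hu => (hder u hu).continuousAt.continuousWithinAt)
      (fun u hu => (hder u (Ico_subset_Icc_self hu)).hasDerivWithinAt) hη
      (fun u hu => ?_) v₁ ⟨hv, le_rfl⟩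
  · exact this.trans (gronwallBound_le_add_mul hη0 (by positivity) hK hv1)
  · have hu' := Ico_subset_Icc_self hu
    have hd := h1 u hu'
    have n1 := hfq _ (haB u hu') _ (hbB u hu')
    have n2 : ‖fderiv ℝ f (a u) (b u - a u - u • g (a u))‖ ≤ K * ‖b u - a u - u • g (a u)‖ :=
      ContinuousLinearMap.le_of_opNorm_le _ (hfd _ (haB u hu')) _
    have n3 := hgl _ (haB u hu') _ (hbB u hu')
    refine norm_add₃_le.trans ((add_le_add_three n1 n2 n3).trans ?_)
    have m1 : K * ‖b u - a u‖ ^ 2 ≤ K * (C * (δ + κ)) ^ 2 := by gcongr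
    -- Here `κ ≤ C * (δ + κ)` because `C ≥ 1`.
    have m2 : κ * ‖b u - a u‖ ≤ (C * (δ + κ)) * (C * (δ + κ)) := by
      gcongr
      nlinarith
    nlinarith

/-- A continuous path starting in `U` stays in `U` if, as long as it does, it stays in a closed
subset of `U`. -/
theorem mem_of_forall_mem_imp_mem_closed {X : Type*} [TopologicalSpace X] {U C : Set X}
    (hU : IsOpen U) (hC : IsClosed C) (hCU : C ⊆ U) {γ : ℝ → X} {v₀ v₁ : ℝ}
    (hγ : ContinuousOn γ (Icc v₀ v₁)) (h0 : γ v₀ ∈ U)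
    (h : ∀ v ∈ Icc v₀ v₁, (∀ u ∈ Icc v₀ v, γ u ∈ U) → γ v ∈ C) :
    ∀ v ∈ Icc v₀ v₁, γ v ∈ U := by
  by_contra! hcon
  obtain ⟨v, hv, hvU⟩ := hcon
  set A : Set ℝ := Icc v₀ v₁ ∩ γ ⁻¹' Uᶜ with hA
  have hAc : IsClosed A := hγ.preimage_isClosed_of_isClosed isClosed_Icc hU.isClosed_compl
  have hAn : A.Nonempty := ⟨v, hv, hvU⟩
  have hAb : BddBelow A := ⟨v₀, fun u hu => hu.1.1⟩
  -- The first exit time: before it the path lies in `C`, so by closedness it lies in `C ⊆ U` at `τ`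
  -- as well.
  set τ := sInf A
  have hτ : τ ∈ A := hAc.csInf_mem hAn hAb
  have hlt : ∀ u ∈ Ico v₀ τ, γ u ∈ U := fun u hu => by
    by_contra hc
    exact (not_lt.2 (csInf_le hAb ⟨⟨hu.1, hu.2.le.trans hτ.1.2⟩, hc⟩)) hu.2
  have hτ0 : v₀ < τ := by
    refine lt_of_le_of_ne hτ.1.1 fun he => hτ.2 ?_
    rw [← he]; exact h0
  have hIco : ∀ u ∈ Ico v₀ τ, γ u ∈ C := fun u hu =>
    h u ⟨hu.1, hu.2.le.trans hτ.1.2⟩ fun w hw => hlt w ⟨hw.1, hw.2.trans_lt hu.2⟩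
  have hcl : τ ∈ closure (Ico v₀ τ) := by
    rw [closure_Ico hτ0.ne]; exact ⟨hτ0.le, le_rfl⟩
  have hcont : ContinuousWithinAt γ (Ico v₀ τ) τ :=
    (hγ τ hτ.1).mono fun u hu => ⟨hu.1, hu.2.le.trans hτ.1.2⟩
  exact hτ.2 (hCU (hC.closure_subset (hcont.mem_closure hcl hIco)))

end Gronwall

/-! ### Vector fields and integral curves read in a chart. -/

section ChartField

variable {m : ℕ} {M : Type*} [TopologicalSpace M] [ChartedSpace (EuclideanSpace ℝ (Fin m)) M]

/-- The coordinate expression of a vector field in the chart around `p`. -/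
def chartField (p : M) (X : VField m M) : EuclideanSpace ℝ (Fin m) → EuclideanSpace ℝ (Fin m) :=
  VectorField.mpullback 𝓘(ℝ, EuclideanSpace ℝ (Fin m)) (𝓡 m) (extChartAt (𝓡 m) p).symm X

/-- The derivative at `y` of the chart around `p`, with values in the model space. -/
def dChart (p y : M) : TangentSpace (𝓡 m) y →L[ℝ] EuclideanSpace ℝ (Fin m) :=
  mfderiv (𝓡 m) 𝓘(ℝ, EuclideanSpace ℝ (Fin m)) (extChartAt (𝓡 m) p) y

/-- The derivative at `z` of the inverse of the chart around `p`. -/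
def dChartSymm (p : M) (z : EuclideanSpace ℝ (Fin m)) :
    EuclideanSpace ℝ (Fin m) →L[ℝ] TangentSpace (𝓡 m) ((extChartAt (𝓡 m) p).symm z) :=
  mfderiv 𝓘(ℝ, EuclideanSpace ℝ (Fin m)) (𝓡 m) (extChartAt (𝓡 m) p).symm z

theorem chartField_add (p : M) (X Y : VField m M) :
    chartField p (X + Y) = chartField p X + chartField p Y :=
  VectorField.mpullback_add

theorem chartField_smul (p : M) (c : ℝ) (X : VField m M) :
    chartField p (c • X) = c • chartField p X :=
  VectorField.mpullback_const_smul

theorem chartField_sum {ι : Type*} (s : Finset ι) (p : M) (X : ι → VField m M) :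
    chartField p (∑ i ∈ s, X i) = ∑ i ∈ s, chartField p (X i) := by
  classical
  induction s using Finset.induction_on with
  | empty =>
    simp only [Finset.sum_empty]
    exact VectorField.mpullback_zero (I := 𝓘(ℝ, EuclideanSpace ℝ (Fin m))) (I' := 𝓡 m)
      (f := (extChartAt (𝓡 m) p).symm)
  | insert i s hi ih => rw [Finset.sum_insert hi, Finset.sum_insert hi, chartField_add, ih]

variable [IsManifold (𝓡 m) ∞ M]

theorem dChart_dChartSymm {p : M} {z : EuclideanSpace ℝ (Fin m)}
    (hz : z ∈ (extChartAt (𝓡 m) p).target) (e : EuclideanSpace ℝ (Fin m)) :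
    dChart p ((extChartAt (𝓡 m) p).symm z) (dChartSymm p z e) = e := by
  have := mfderiv_extChartAt_comp_mfderivWithin_extChartAt_symm (I := 𝓡 m) hz
  rw [modelWithCornersSelf_coe, range_id, mfderivWithin_univ] at this
  exact DFunLike.congr_fun this e

theorem dChartSymm_dChart {p : M} {z : EuclideanSpace ℝ (Fin m)}
    (hz : z ∈ (extChartAt (𝓡 m) p).target)
    (v : TangentSpace (𝓡 m) ((extChartAt (𝓡 m) p).symm z)) :
    dChartSymm p z (dChart p ((extChartAt (𝓡 m) p).symm z) v) = v := by
  have := mfderivWithin_extChartAt_symm_comp_mfderiv_extChartAt (I := 𝓡 m) hz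
  rw [modelWithCornersSelf_coe, range_id, mfderivWithin_univ] at this
  exact DFunLike.congr_fun this v

/-- The two vectors belong to tangent spaces at points that are equal only propositionally, so both
are read in the model space. -/
theorem dChartSymm_dChart_apply {p y : M} (hy : y ∈ (extChartAt (𝓡 m) p).source)
    (v : TangentSpace (𝓡 m) y) :
    (show EuclideanSpace ℝ (Fin m) from dChartSymm p (extChartAt (𝓡 m) p y) (dChart p y v)) =
      (show EuclideanSpace ℝ (Fin m) from v) := by
  obtain ⟨z, hz, rfl⟩ : ∃ z ∈ (extChartAt (𝓡 m) p).target, y = (extChartAt (𝓡 m) p).symm z :=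
    ⟨_, (extChartAt (𝓡 m) p).map_source hy, ((extChartAt (𝓡 m) p).left_inv hy).symm⟩
  let f : EuclideanSpace ℝ (Fin m) → EuclideanSpace ℝ (Fin m) → EuclideanSpace ℝ (Fin m) :=
    fun z w => dChartSymm p z w
  have h : ∀ w, f (extChartAt (𝓡 m) p ((extChartAt (𝓡 m) p).symm z)) w = f z w := fun w => by
    rw [(extChartAt (𝓡 m) p).right_inv hz]
  exact (h _).trans (dChartSymm_dChart hz v)

theorem isInvertible_dChartSymm {p : M} {z : EuclideanSpace ℝ (Fin m)}
    (hz : z ∈ (extChartAt (𝓡 m) p).target) :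
    (mfderiv 𝓘(ℝ, EuclideanSpace ℝ (Fin m)) (𝓡 m) (extChartAt (𝓡 m) p).symm z).IsInvertible := by
  have := isInvertible_mfderivWithin_extChartAt_symm (I := 𝓡 m) hz
  rwa [modelWithCornersSelf_coe, range_id, mfderivWithin_univ] at this

theorem chartField_eq {p : M} (X : VField m M) {z : EuclideanSpace ℝ (Fin m)}
    (hz : z ∈ (extChartAt (𝓡 m) p).target) :
    chartField p X z = dChart p ((extChartAt (𝓡 m) p).symm z) (X ((extChartAt (𝓡 m) p).symm z)) := by
  have h1 : dChartSymm p z (chartField p X z) = X ((extChartAt (𝓡 m) p).symm z) := by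
    unfold dChartSymm chartField
    rw [VectorField.mpullback_apply]
    obtain ⟨e, he⟩ := isInvertible_dChartSymm hz
    rw [← he, ContinuousLinearMap.inverse_equiv]
    exact e.apply_symm_apply _
  rw [← h1, dChart_dChartSymm hz]

theorem dChartSymm_chartField {p : M} (X : VField m M) {z : EuclideanSpace ℝ (Fin m)}
    (hz : z ∈ (extChartAt (𝓡 m) p).target) :
    dChartSymm p z (chartField p X z) = X ((extChartAt (𝓡 m) p).symm z) := by
  rw [chartField_eq X hz, dChartSymm_dChart hz]

theorem chartField_apply {p y : M} (X : VField m M) (hy : y ∈ (extChartAt (𝓡 m) p).source) :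
    chartField p X (extChartAt (𝓡 m) p y) = dChart p y (X y) := by
  rw [chartField_eq X ((extChartAt (𝓡 m) p).map_source hy), (extChartAt (𝓡 m) p).left_inv hy]

theorem contMDiffAt_extChartAt_symm {p : M} {z : EuclideanSpace ℝ (Fin m)}
    (hz : z ∈ (extChartAt (𝓡 m) p).target) :
    ContMDiffAt 𝓘(ℝ, EuclideanSpace ℝ (Fin m)) (𝓡 m) ∞ (extChartAt (𝓡 m) p).symm z :=
  (contMDiffOn_extChartAt_symm p).contMDiffAt ((isOpen_extChartAt_target p).mem_nhds hz)

theorem contDiffOn_chartField (p : M) {X : VField m M} (hX : SmoothVField X) :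
    ContDiffOn ℝ ∞ (chartField p X) (extChartAt (𝓡 m) p).target := by
  intro z hz
  refine ContDiffAt.contDiffWithinAt ?_
  have := ContMDiffAt.mpullback_vectorField_preimage (m := ∞) (hX _)
    (contMDiffAt_extChartAt_symm hz) (isInvertible_dChartSymm hz) (by simp)
  exact contMDiffAt_vectorSpace_iff_contDiffAt.1 this

/-- Naturality of the bracket under pullback by the inverse chart. -/
theorem lieBracket_chartField {p : M} {X Y : VField m M} (hX : SmoothVField X)
    (hY : SmoothVField Y) (h : VectorField.mlieBracket (𝓡 m) X Y = 0)
    {z : EuclideanSpace ℝ (Fin m)} (hz : z ∈ (extChartAt (𝓡 m) p).target) :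
    VectorField.lieBracket ℝ (chartField p X) (chartField p Y) z = 0 := by
  have : IsManifold (𝓡 m) (minSmoothness ℝ 2) M := by
    rw [minSmoothness_of_isRCLikeNormedField]; infer_instance
  have := VectorField.mpullback_mlieBracket (I := 𝓘(ℝ, EuclideanSpace ℝ (Fin m))) (I' := 𝓡 m)
    (V := X) (W := Y)
    ((hX _).mdifferentiableAt (by simp)) ((hY _).mdifferentiableAt (by simp))
    (contMDiffAt_extChartAt_symm hz) (by
      rw [minSmoothness_of_isRCLikeNormedField]; exact WithTop.coe_le_coe.2 le_top)
  rw [h, VectorField.mpullback_zero] at this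
  rw [← VectorField.mlieBracketWithin_univ, VectorField.mlieBracketWithin_eq_lieBracketWithin]
    at this
  rw [← VectorField.lieBracketWithin_univ]
  exact this.symm

theorem fderiv_chartField_comm {p : M} {X Y : VField m M} (hX : SmoothVField X)
    (hY : SmoothVField Y) (h : VectorField.mlieBracket (𝓡 m) X Y = 0)
    {z : EuclideanSpace ℝ (Fin m)} (hz : z ∈ (extChartAt (𝓡 m) p).target) :
    fderiv ℝ (chartField p X) z (chartField p Y z) =
      fderiv ℝ (chartField p Y) z (chartField p X z) :=
  (sub_eq_zero.1 (lieBracket_chartField hX hY h hz)).symm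

variable {E : Type*} [NormedAddCommGroup E] [NormedSpace ℝ E]

theorem hasFDerivAt_extChartAt_comp {p : M} {G : E → M} {t : E}
    {A : E →L[ℝ] TangentSpace (𝓡 m) (G t)} (hG : HasMFDerivAt 𝓘(ℝ, E) (𝓡 m) G t A)
    (ht : G t ∈ (extChartAt (𝓡 m) p).source) :
    HasFDerivAt (fun u => extChartAt (𝓡 m) p (G u)) (dChart p (G t) ∘L A) t := by
  rw [extChartAt_source] at ht
  have h1 : HasMFDerivAt (𝓡 m) 𝓘(ℝ, EuclideanSpace ℝ (Fin m)) (extChartAt (𝓡 m) p) (G t)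
      (dChart p (G t)) :=
    ((contMDiffAt_extChartAt' (n := ∞) ht).mdifferentiableAt (by simp)).hasMFDerivAt
  exact hasMFDerivAt_iff_hasFDerivAt.1 (h1.comp t hG)

/-- Continuity of `G` need not be known beforehand: near `t`, `G` is the inverse chart applied to
its coordinate expression. -/
theorem hasMFDerivAt_of_extChartAt_comp {p : M} {G : E → M} {t : E}
    {A : E →L[ℝ] TangentSpace (𝓡 m) (G t)}
    (hs : ∀ᶠ u in 𝓝 t, G u ∈ (extChartAt (𝓡 m) p).source)
    (hG : HasFDerivAt (fun u => extChartAt (𝓡 m) p (G u)) (dChart p (G t) ∘L A) t) :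
    HasMFDerivAt 𝓘(ℝ, E) (𝓡 m) G t A := by
  have ht := hs.self_of_nhds
  have hz := (extChartAt (𝓡 m) p).map_source ht
  have h1 : HasMFDerivAt 𝓘(ℝ, EuclideanSpace ℝ (Fin m)) (𝓡 m) (extChartAt (𝓡 m) p).symm
      (extChartAt (𝓡 m) p (G t)) (dChartSymm p (extChartAt (𝓡 m) p (G t))) :=
    ((contMDiffAt_extChartAt_symm hz).mdifferentiableAt (by simp)).hasMFDerivAt
  have h2 := h1.comp t (hasMFDerivAt_iff_hasFDerivAt.2 hG)
  have h3 : G =ᶠ[𝓝 t] (extChartAt (𝓡 m) p).symm ∘ fun u => extChartAt (𝓡 m) p (G u) :=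
    hs.mono fun u hu => ((extChartAt (𝓡 m) p).left_inv hu).symm
  have h4 := h2.congr_of_eventuallyEq h3
  refine h4.congr_mfderiv ?_
  exact ContinuousLinearMap.ext fun v => dChartSymm_dChart_apply ht (A v)

theorem IsMIntegralCurve.hasDerivAt_extChartAt {p : M} {γ : ℝ → M} {X : VField m M} {v : ℝ}
    (hγ : HasMFDerivAt 𝓘(ℝ, ℝ) (𝓡 m) γ v ((1 : ℝ →L[ℝ] ℝ).smulRight (X (γ v))))
    (hv : γ v ∈ (extChartAt (𝓡 m) p).source) :
    HasDerivAt (fun u => extChartAt (𝓡 m) p (γ u))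
      (chartField p X (extChartAt (𝓡 m) p (γ v))) v := by
  have := hasFDerivAt_extChartAt_comp hγ hv
  rw [chartField_apply X hv]
  refine this.hasDerivAt.congr_deriv ?_
  change dChart p (γ v) ((1 : ℝ →L[ℝ] ℝ) 1 • X (γ v)) = _
  simp

end ChartField

/-! ### Differentiating the joint flow of commuting fields in its coefficients. -/

section CommutingFields

open Metric Asymptotics

variable {m : ℕ} {M : Type*} [TopologicalSpace M] [ChartedSpace (EuclideanSpace ℝ (Fin m)) M]
  {ι : Type*} [Fintype ι]

/-- The linear combination of the vector fields `X i` with constant coefficients `t i`. -/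
def comb (X : ι → VField m M) (t : ι → ℝ) : VField m M := ∑ i, t i • X i

/-- The value at `y` of a constant linear combination of the `X i`, as a function of the
coefficients. -/
def evalMap (X : ι → VField m M) (y : M) : (ι → ℝ) →L[ℝ] TangentSpace (𝓡 m) y :=
  ∑ i, (ContinuousLinearMap.proj (R := ℝ) (φ := fun _ : ι => ℝ) i).smulRight (X i y)

theorem evalMap_apply (X : ι → VField m M) (y : M) (t : ι → ℝ) :
    evalMap X y t = comb X t y := by
  simp [evalMap, comb, Finset.sum_apply]

theorem comb_add (X : ι → VField m M) (s t : ι → ℝ) : comb X (s + t) = comb X s + comb X t := by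
  simp [comb, add_smul, Finset.sum_add_distrib]

theorem comb_mem {𝒳 : Submodule ℝ (VField m M)} {X : ι → VField m M} (hX : ∀ i, X i ∈ 𝒳)
    (t : ι → ℝ) : comb X t ∈ 𝒳 :=
  Submodule.sum_mem _ fun i _ => Submodule.smul_mem _ _ (hX i)

theorem chartField_comb (p : M) (X : ι → VField m M) (t : ι → ℝ) (z : EuclideanSpace ℝ (Fin m)) :
    chartField p (comb X t) z = ∑ i, t i • chartField p (X i) z := by
  simp [comb, chartField_sum, chartField_smul, Finset.sum_apply]

variable [IsManifold (𝓡 m) ∞ M]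

/-- Linearity in `h` makes size and Lipschitz constant proportional to `‖h‖`; this is what turns the
Gronwall error into `O(‖t - t₀‖²)`. -/
theorem exists_bound_chartField_comb {p : M} {X : ι → VField m M} (hX : ∀ i, SmoothVField (X i))
    {B : Set (EuclideanSpace ℝ (Fin m))} (hB : IsCompact B) (hc : Convex ℝ B)
    (hBT : B ⊆ (extChartAt (𝓡 m) p).target) :
    ∃ K : ℝ, 0 ≤ K ∧ ∀ h : ι → ℝ, (∀ z ∈ B, ‖chartField p (comb X h) z‖ ≤ K * ‖h‖) ∧
      ∀ z ∈ B, ∀ z' ∈ B, ‖chartField p (comb X h) z' - chartField p (comb X h) z‖ ≤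
        K * ‖h‖ * ‖z' - z‖ := by
  choose K hK0 hK1 _ hK2 _ using fun i => exists_bound_of_contDiffOn
    (isOpen_extChartAt_target p) hB hc hBT (contDiffOn_chartField p (hX i))
  refine ⟨∑ i, K i, Finset.sum_nonneg fun i _ => hK0 i, fun h => ⟨fun z hz => ?_,
    fun z hz z' hz' => ?_⟩⟩
  · rw [chartField_comb, Finset.sum_mul]
    refine norm_sum_le_of_le _ fun i _ => ?_
    rw [norm_smul, mul_comm]
    gcongr
    exacts [hK0 i, hK1 i z hz, norm_le_pi_norm h i]
  · rw [chartField_comb, chartField_comb, ← Finset.sum_sub_distrib, Finset.sum_mul, Finset.sum_mul]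
    refine norm_sum_le_of_le _ fun i _ => ?_
    rw [← smul_sub, norm_smul]
    calc ‖h i‖ * ‖chartField p (X i) z' - chartField p (X i) z‖ ≤ ‖h‖ * (K i * ‖z' - z‖) := by
          gcongr
          exacts [norm_le_pi_norm h i, hK2 i z hz z' hz']
      _ = _ := by ring

variable [T2Space M]

/-- An integral curve that starts near the centre of a chart stays in the chart for some time. -/
theorem extChartAt_mem_ball_of_speed_le {p : M} {R L v₀ v₁ : ℝ} {γ : ℝ → M} {Y : VField m M}
    (hR : closedBall (extChartAt (𝓡 m) p p) R ⊆ (extChartAt (𝓡 m) p).target) (hL0 : 0 ≤ L)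
    (hL : ∀ z ∈ closedBall (extChartAt (𝓡 m) p p) R, ‖chartField p Y z‖ ≤ L)
    (hγ : ∀ v ∈ Icc v₀ v₁,
      HasMFDerivAt 𝓘(ℝ, ℝ) (𝓡 m) γ v ((1 : ℝ →L[ℝ] ℝ).smulRight (Y (γ v))))
    (hv : L * (v₁ - v₀) ≤ R / 4) (hR0 : 0 < R)
    (h0 : γ v₀ ∈ (extChartAt (𝓡 m) p).source)
    (h0' : extChartAt (𝓡 m) p (γ v₀) ∈ ball (extChartAt (𝓡 m) p p) (R / 2)) :
    ∀ v ∈ Icc v₀ v₁, γ v ∈ (extChartAt (𝓡 m) p).source ∧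
      extChartAt (𝓡 m) p (γ v) ∈ ball (extChartAt (𝓡 m) p p) R := by
  set φ := extChartAt (𝓡 m) p with hφ
  -- The radius is `R / 2` for the starting point plus `R / 4` for the distance travelled, still
  -- less than `R`.
  have hCT : closedBall (φ p) (3 * R / 4) ⊆ φ.target :=
    (closedBall_subset_closedBall (by linarith)).trans hR
  have hU : IsOpen (φ.source ∩ φ ⁻¹' ball (φ p) R) := isOpen_extChartAt_preimage' p isOpen_ball
  -- Closed in all of `M`, as a compact subset of a Hausdorff space.
  have hC : IsClosed (φ.symm '' closedBall (φ p) (3 * R / 4)) :=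
    ((isCompact_closedBall _ _).image_of_continuousOn
      ((continuousOn_extChartAt_symm p).mono hCT)).isClosed
  refine mem_of_forall_mem_imp_mem_closed hU hC ?_
    (fun v hv => (hγ v hv).continuousAt.continuousWithinAt)
    ⟨h0, ball_subset_ball (by linarith) h0'⟩ fun v hvI hstay => ?_
  · rintro _ ⟨z, hz, rfl⟩
    refine ⟨φ.map_target (hCT hz), ?_⟩
    rw [mem_preimage, φ.right_inv (hCT hz)]
    exact closedBall_subset_ball (by linarith) hz
  · have hs := hstay v ⟨hvI.1, le_rfl⟩
    refine ⟨φ (γ v), ?_, φ.left_inv hs.1⟩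
    have := norm_image_sub_le_of_norm_deriv_le_segment' (f := fun u => φ (γ u))
      (f' := fun u => chartField p Y (φ (γ u))) (C := L) (a := v₀) (b := v)
      (fun u hu => (IsMIntegralCurve.hasDerivAt_extChartAt (hγ u ⟨hu.1, hu.2.trans hvI.2⟩)
        (hstay u hu).1).hasDerivWithinAt)
      (fun u hu => hL _ (ball_subset_closedBall (hstay u (Ico_subset_Icc_self hu)).2))
      v ⟨hvI.1, le_rfl⟩
    rw [mem_ball, dist_eq_norm] at h0'
    rw [mem_closedBall, dist_eq_norm]
    have h3 : ‖φ (γ v) - φ p‖ ≤ ‖φ (γ v) - φ (γ v₀)‖ + ‖φ (γ v₀) - φ p‖ :=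
      norm_sub_le_norm_sub_add_norm_sub _ _ _
    have h4 : L * (v - v₀) ≤ L * (v₁ - v₀) := by
      gcongr; exact hvI.2
    have h5 : ‖φ (γ v) - φ (γ v₀)‖ ≤ L * (v - v₀) := this
    linarith

/-- For a family of integral curves of commuting vector fields, differentiability with respect to
the coefficients, with the expected derivative, propagates in time. -/
theorem exists_hasMFDerivAt_coeff_propagate {𝒳 : Submodule ℝ (VField m M)}
    (hs : ∀ Y ∈ 𝒳, SmoothVField Y)
    (hab : ∀ Y ∈ 𝒳, ∀ Z ∈ 𝒳, VectorField.mlieBracket (𝓡 m) Y Z = 0)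
    {X : ι → VField m M} (hX : ∀ i, X i ∈ 𝒳) {γ : (ι → ℝ) → ℝ → M}
    (hγ : ∀ t, IsMIntegralCurve (γ t) (comb X t)) (t₀ : ι → ℝ) (w : ℝ) :
    ∃ ε > 0, ∀ v₀ v₁, |v₀ - w| < ε → |v₁ - w| < ε → v₀ ≤ v₁ →
      HasMFDerivAt 𝓘(ℝ, ι → ℝ) (𝓡 m) (fun t => γ t v₀) t₀ (v₀ • evalMap X (γ t₀ v₀)) →
      HasMFDerivAt 𝓘(ℝ, ι → ℝ) (𝓡 m) (fun t => γ t v₁) t₀ (v₁ • evalMap X (γ t₀ v₁)) := by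
  set p := γ t₀ w with hp
  set φ := extChartAt (𝓡 m) p with hφ
  obtain ⟨R, hR0, hR⟩ : ∃ R > 0, closedBall (φ p) R ⊆ φ.target :=
    nhds_basis_closedBall.mem_iff.1 (extChartAt_target_mem_nhds p)
  set B := closedBall (φ p) R with hB
  have hBc : IsCompact B := isCompact_closedBall _ _
  have hBx : Convex ℝ B := convex_closedBall _ _
  obtain ⟨K₁, hK₁0, -, hfd, hfl, hfq⟩ := exists_bound_of_contDiffOn
    (isOpen_extChartAt_target p) hBc hBx hR (contDiffOn_chartField p (hs _ (comb_mem hX t₀)))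
  obtain ⟨K₂, hK₂0, hK₂⟩ := exists_bound_chartField_comb (fun i => hs _ (hX i)) hBc hBx hR
  -- A speed bound valid for all `t` within distance 1 of `t₀`.
  set L := K₂ * (‖t₀‖ + 1) with hL
  have hL0 : 0 ≤ L := by positivity
  have hU' : IsOpen (φ.source ∩ φ ⁻¹' ball (φ p) (R / 2)) :=
    isOpen_extChartAt_preimage' p isOpen_ball
  have hpU : γ t₀ w ∈ φ.source ∩ φ ⁻¹' ball (φ p) (R / 2) :=
    ⟨mem_extChartAt_source p, mem_ball_self (by positivity)⟩
  obtain ⟨ε₁, hε₁, hε₁'⟩ := Metric.mem_nhds_iff.1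
    ((hγ t₀).continuous.continuousAt.preimage_mem_nhds (hU'.mem_nhds hpU))
  -- `ε₁` keeps `γ t₀ v₀` in the half-size ball, `1 / 2` gives `v₁ - v₀ ≤ 1` for the Gronwall
  -- constant, and the last term bounds the distance travelled by `R / 4`.
  refine ⟨min ε₁ (min (1 / 2) (R / (8 * (L + 1)))), by positivity,
    fun v₀ v₁ hv₀ hv₁ hv hS => ?_⟩
  have hv10 : v₁ - v₀ ≤ 1 := by
    have h1 := abs_lt.1 (hv₀.trans_le ((min_le_right _ _).trans (min_le_left _ _)))
    have h2 := abs_lt.1 (hv₁.trans_le ((min_le_right _ _).trans (min_le_left _ _)))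
    linarith [h1.1, h2.2]
  have hLv : L * (v₁ - v₀) ≤ R / 4 := by
    have h1 := abs_lt.1 (hv₀.trans_le ((min_le_right _ _).trans (min_le_right _ _)))
    have h2 := abs_lt.1 (hv₁.trans_le ((min_le_right _ _).trans (min_le_right _ _)))
    have h3 : v₁ - v₀ ≤ 2 * (R / (8 * (L + 1))) := by linarith [h1.1, h2.2]
    calc L * (v₁ - v₀) ≤ (L + 1) * (2 * (R / (8 * (L + 1)))) := by
          gcongr
          linarith
      _ = R / 4 := by field_simp; norm_num
  have hv₀U : γ t₀ v₀ ∈ φ.source ∩ φ ⁻¹' ball (φ p) (R / 2) :=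
    hε₁' (by rw [mem_ball, Real.dist_eq]; exact hv₀.trans_le (min_le_left _ _))
  have hev : ∀ᶠ t in 𝓝 t₀, ∀ v ∈ Icc v₀ v₁, γ t v ∈ φ.source ∧ φ (γ t v) ∈ ball (φ p) R := by
    filter_upwards [hS.continuousAt.preimage_mem_nhds (hU'.mem_nhds hv₀U),
      ball_mem_nhds t₀ one_pos] with t ht ht1
    refine extChartAt_mem_ball_of_speed_le (Y := comb X t) hR hL0 (fun z hz => ?_)
      (fun v _ => hγ t v) hLv hR0 ht.1 ht.2
    refine ((hK₂ t).1 z hz).trans ?_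
    have : ‖t‖ ≤ ‖t₀‖ + 1 := by
      have h1 := norm_le_norm_add_norm_sub' t t₀
      rw [mem_ball, dist_eq_norm] at ht1
      linarith
    exact mul_le_mul_of_nonneg_left this hK₂0
  have hS' := hasFDerivAt_extChartAt_comp hS hv₀U.1
  refine hasMFDerivAt_of_extChartAt_comp (p := p)
    (hev.mono fun t ht => (ht v₁ ⟨hv, le_rfl⟩).1) ?_
  have hval : ∀ v ∈ Icc v₀ v₁, ∀ h : ι → ℝ,
      (dChart p (γ t₀ v) ∘L (v • evalMap X (γ t₀ v))) h =
        v • chartField p (comb X h) (φ (γ t₀ v)) := by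
    intro v hv' h
    have hsrc := (hev.self_of_nhds v hv').1
    rw [chartField_apply _ hsrc, ← evalMap_apply]
    exact (dChart p (γ t₀ v)).map_smul v _
  -- Differentiability at time `v₀` is used twice: its `O` part gives the initial distance `δ = c *
  -- ‖t - t₀‖`, its `o` part the initial second-order error `η`.
  obtain ⟨c, hc⟩ := hS'.isBigO_sub.bound
  have ho := hS'.isLittleO
  set K := max K₁ K₂ with hK
  set C := gronwallBound 1 K 1 1 with hC
  have hK0 : 0 ≤ K := hK₁0.trans (le_max_left _ _)
  rw [hasFDerivAt_iff_isLittleO]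
  have hbig : (fun t => φ (γ t v₁) - φ (γ t₀ v₁) -
      (dChart p (γ t₀ v₁) ∘L (v₁ • evalMap X (γ t₀ v₁))) (t - t₀)) =O[𝓝 t₀]
      fun t => (‖φ (γ t v₀) - φ (γ t₀ v₀) -
        (dChart p (γ t₀ v₀) ∘L (v₀ • evalMap X (γ t₀ v₀))) (t - t₀)‖ +
          (K + 1) * (C * (c * ‖t - t₀‖ + K * ‖t - t₀‖)) ^ 2) * C := by
    refine IsBigO.of_bound 1 ?_
    filter_upwards [hev, hc] with t ht hct
    have ht₀ := hev.self_of_nhds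
    rw [hval v₁ ⟨hv, le_rfl⟩, hval v₀ ⟨le_rfl, hv⟩, one_mul]
    refine le_trans ?_ (le_abs_self _)
    refine norm_sub_sub_smul_le_of_commute (B := B) (f := chartField p (comb X t₀))
      (g := chartField p (comb X (t - t₀))) (K := K) (κ := K * ‖t - t₀‖)
      (a := fun v => φ (γ t₀ v)) (b := fun v => φ (γ t v)) hK0 (by positivity)
      (fun z hz => (hfd z hz).trans (le_max_left _ _))
      (fun z hz z' hz' => (hfl z hz z' hz').trans (by gcongr; exact le_max_left _ _))
      (fun z hz z' hz' => (hfq z hz z' hz').trans (by gcongr; exact le_max_left _ _))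
      (fun z hz => ((contDiffOn_chartField p (hs _ (comb_mem hX _))).contDiffAt
        ((isOpen_extChartAt_target p).mem_nhds (hR hz))).differentiableAt (by simp))
      (fun z hz => ((hK₂ _).1 z hz).trans (by gcongr; exact le_max_right _ _))
      (fun z hz z' hz' => ((hK₂ _).2 z hz z' hz').trans (by gcongr; exact le_max_right _ _))
      (fun z hz => fderiv_chartField_comm (hs _ (comb_mem hX _)) (hs _ (comb_mem hX _))
        (hab _ (comb_mem hX _) _ (comb_mem hX _)) (hR hz)) hv hv10
      (fun v hv' => IsMIntegralCurve.hasDerivAt_extChartAt (hγ t₀ v) (ht₀ v hv').1)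
      (fun v hv' => ball_subset_closedBall (ht₀ v hv').2) (fun v hv' => ?_)
      (fun v hv' => ball_subset_closedBall (ht v hv').2) hct le_rfl
    have := IsMIntegralCurve.hasDerivAt_extChartAt (hγ t v) (ht v hv').1
    have heq : comb X t = comb X t₀ + comb X (t - t₀) := by rw [← comb_add]; simp
    have heq' : chartField p (comb X t) =
      chartField p (comb X t₀) + chartField p (comb X (t - t₀)) := by rw [heq, chartField_add]
    rw [heq'] at this
    exact this
  refine hbig.trans_isLittleO ?_
  have h1 : (fun t : ι → ℝ => (K + 1) * (C * (c * ‖t - t₀‖ + K * ‖t - t₀‖)) ^ 2) =o[𝓝 t₀]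
      fun t => t - t₀ := by
    have : (fun t : ι → ℝ => (K + 1) * (C * (c * ‖t - t₀‖ + K * ‖t - t₀‖)) ^ 2) =
        fun t => ((K + 1) * (C * (c + K)) ^ 2) * ‖t - t₀‖ ^ 2 := by
      funext t; ring
    rw [this]
    exact (isLittleO_pow_sub_sub t₀ one_lt_two).const_mul_left _
  have h2 := (ho.norm_left.add h1).const_mul_left C
  refine h2.congr_left fun t => ?_
  ring

/-- Let `γ t` be the integral curve of `∑ t i • X i` from a fixed point, where the vector fields
`X i` commute. Then `t ↦ γ t 1` has derivative `h ↦ ∑ h i • X i`. -/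
theorem hasMFDerivAt_integralCurve_coeff {𝒳 : Submodule ℝ (VField m M)}
    (hs : ∀ Y ∈ 𝒳, SmoothVField Y)
    (hab : ∀ Y ∈ 𝒳, ∀ Z ∈ 𝒳, VectorField.mlieBracket (𝓡 m) Y Z = 0)
    {X : ι → VField m M} (hX : ∀ i, X i ∈ 𝒳) {γ : (ι → ℝ) → ℝ → M} {x : M}
    (hγ : ∀ t, IsMIntegralCurve (γ t) (comb X t)) (h0 : ∀ t, γ t 0 = x) (t₀ : ι → ℝ) :
    HasMFDerivAt 𝓘(ℝ, ι → ℝ) (𝓡 m) (fun t => γ t 1) t₀ (evalMap X (γ t₀ 1)) := by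
  let S : ℝ → Prop := fun v =>
    HasMFDerivAt 𝓘(ℝ, ι → ℝ) (𝓡 m) (fun t => γ t v) t₀ (v • evalMap X (γ t₀ v))
  have hS0 : S 0 := by
    have : (fun t => γ t 0) = fun _ => x := funext h0
    simp only [S, zero_smul]
    rw [this]
    exact hasMFDerivAt_const x t₀
  have key := exists_hasMFDerivAt_coeff_propagate hs hab hX hγ t₀
  let A : Set ℝ := {v | v ∈ Icc 0 1 ∧ S v}
  have hA0 : (0 : ℝ) ∈ A := ⟨⟨le_rfl, zero_le_one⟩, hS0⟩
  have hAb : BddAbove A := ⟨1, fun v hv => hv.1.2⟩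
  set τ := sSup A with hτ
  have hτ0 : 0 ≤ τ := le_csSup hAb hA0
  have hτ1 : τ ≤ 1 := csSup_le ⟨0, hA0⟩ fun v hv => hv.1.2
  obtain ⟨ε, hε, hprop⟩ := key τ
  obtain ⟨v₀, hv₀A, hv₀⟩ := exists_lt_of_lt_csSup ⟨0, hA0⟩ (show τ - ε < sSup A by linarith)
  have hv₀τ : v₀ ≤ τ := le_csSup hAb hv₀A
  have hv₀' : |v₀ - τ| < ε := by rw [abs_lt]; constructor <;> linarith
  -- The window around `τ` is two-sided, so one good time `v₀` just before `τ` reaches `τ` and also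
  -- times beyond it.
  have hSτ : ∀ v₁, |v₁ - τ| < ε → v₀ ≤ v₁ → S v₁ := fun v₁ h1 h2 =>
    hprop v₀ v₁ hv₀' h1 h2 hv₀A.2
  have hτeq : τ = 1 := by
    by_contra hne
    have hlt : τ < 1 := lt_of_le_of_ne hτ1 hne
    have h1 : min 1 (τ + ε / 2) ∈ A := by
      have h2 : τ ≤ min 1 (τ + ε / 2) := le_min hτ1 (by linarith)
      refine ⟨⟨hτ0.trans h2, min_le_left _ _⟩, hSτ _ ?_ (hv₀τ.trans h2)⟩
      rw [abs_of_nonneg (by linarith)]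
      linarith [min_le_right 1 (τ + ε / 2)]
    have h3 : min 1 (τ + ε / 2) ≤ τ := le_csSup hAb h1
    exact absurd h3 (not_le.2 (lt_min hlt (by linarith)))
  have := hSτ 1 (by rw [hτeq]; simpa using hε) (hv₀τ.trans hτ1)
  simpa only [S, one_smul] using this

end CommutingFields

/-! ### Completeness on compact invariant sets. -/

section Completeness

open Metric

variable {m : ℕ} {M : Type*} [TopologicalSpace M] [ChartedSpace (EuclideanSpace ℝ (Fin m)) M]
  [IsManifold (𝓡 m) ∞ M]

/-- Local integral curves exist for a time that is locally uniform in the initial point. -/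
theorem exists_nhds_forall_exists_isMIntegralCurveOn {X : VField m M} (hX : SmoothVField X)
    (p : M) : ∃ U ∈ 𝓝 p, ∃ ε > 0, ∀ y ∈ U, ∃ γ : ℝ → M, γ 0 = y ∧
      IsMIntegralCurveOn (I := 𝓡 m) γ X (Ioo (-ε) ε) := by
  set φ := extChartAt (𝓡 m) p with hφ
  have hT : IsOpen φ.target := isOpen_extChartAt_target p
  have hC : ContDiffAt ℝ 1 (chartField p X) (φ p) :=
    ((contDiffOn_chartField p hX).contDiffAt (extChartAt_target_mem_nhds p)).of_le (by simp)
  obtain ⟨ε, hε, a, r, L, K, hr, hPL⟩ := IsPicardLindelof.of_contDiffAt_one hC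
  obtain ⟨α, hα, hαc⟩ :=
    (hPL 0).exists_forall_mem_closedBall_eq_hasDerivWithinAt_continuousOn
  have hr' : (0 : ℝ) < r := hr
  have hnhds : closedBall (φ p) r ×ˢ Icc (0 - ε) (0 + ε) ∈ 𝓝 (φ p, (0 : ℝ)) :=
    prod_mem_nhds (closedBall_mem_nhds _ hr') (Icc_mem_nhds (by linarith) (by linarith))
  have hα0 : α (φ p, 0) = φ p := (hα _ (mem_closedBall_self hr'.le)).1
  -- Joint continuity of the local flow keeps all nearby solutions in the chart for a common time.
  have hpre : α ⁻¹' φ.target ∈ 𝓝 (φ p, (0 : ℝ)) := by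
    refine (hαc.continuousAt hnhds).preimage_mem_nhds ?_
    rw [hα0]; exact extChartAt_target_mem_nhds p
  obtain ⟨δ, hδ, hball⟩ := Metric.mem_nhds_iff.1 (Filter.inter_mem hpre hnhds)
  refine ⟨φ.source ∩ φ ⁻¹' ball (φ p) δ, (isOpen_extChartAt_preimage' p isOpen_ball).mem_nhds
    ⟨mem_extChartAt_source p, mem_ball_self hδ⟩, min δ ε, by positivity, fun y hy => ?_⟩
  have hmem : ∀ t ∈ Ioo (-min δ ε) (min δ ε), (φ y, t) ∈ ball (φ p, (0 : ℝ)) δ := fun t ht => by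
    rw [← ball_prod_same, mem_prod]
    refine ⟨hy.2, ?_⟩
    rw [mem_ball, Real.dist_eq, sub_zero]
    exact (abs_lt.2 ht).trans_le (min_le_left _ _)
  have h0 : (0 : ℝ) ∈ Ioo (-min δ ε) (min δ ε) := ⟨by simp [hδ, hε], by simp [hδ, hε]⟩
  have hyr := (hball (hmem 0 h0)).2.1
  refine ⟨fun t => φ.symm (α (φ y, t)), ?_, fun t ht => ?_⟩
  · simp only [(hα _ hyr).1, φ.left_inv hy.1]
  · have hzT : α (φ y, t) ∈ φ.target := (hball (hmem t ht)).1
    have hd : HasDerivAt (fun u => α (φ y, u)) (chartField p X (α (φ y, t))) t := by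
      have htε : |t| < ε := (abs_lt.2 ht).trans_le (min_le_right _ _)
      rw [abs_lt] at htε
      exact ((hα _ hyr).2 t (hball (hmem t ht)).2.2).hasDerivAt
        (Icc_mem_nhds (by linarith) (by linarith))
    have hevT : ∀ᶠ u in 𝓝 t, α (φ y, u) ∈ φ.target :=
      hd.continuousAt.preimage_mem_nhds (hT.mem_nhds hzT)
    refine HasMFDerivAt.hasMFDerivWithinAt ?_
    refine hasMFDerivAt_of_extChartAt_comp (p := p) (hevT.mono fun u hu => φ.map_target hu) ?_
    have heq : (fun u => extChartAt (𝓡 m) p (φ.symm (α (φ y, u)))) =ᶠ[𝓝 t]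
        fun u => α (φ y, u) := hevT.mono fun u hu => φ.right_inv hu
    refine HasFDerivAt.congr_of_eventuallyEq ?_ heq
    refine hd.hasFDerivAt.congr_fderiv ?_
    rw [chartField_eq X hzT]
    refine ContinuousLinearMap.ext fun c => ?_
    exact ((dChart p (φ.symm (α (φ y, t)))).map_smul c _).symm

variable [T2Space M]

/-- An integral curve through a compact invariant set is defined for all times. -/
theorem exists_isMIntegralCurve_of_isCompact {X : VField m M} (hX : SmoothVField X) {K : Set M}
    (hK : IsCompact K)
    (hinv : ∀ (γ : ℝ → M) (a : ℝ), IsMIntegralCurveOn (I := 𝓡 m) γ X (Ioo (-a) a) → γ 0 ∈ K →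
      ∀ t ∈ Ioo (-a) a, γ t ∈ K) {x : M} (hx : x ∈ K) :
    ∃ γ : ℝ → M, γ 0 = x ∧ IsMIntegralCurve (I := 𝓡 m) γ X := by
  obtain ⟨ε, hε, h⟩ : ∃ ε > 0, ∀ y ∈ K, ∃ γ : ℝ → M, γ 0 = y ∧
      IsMIntegralCurveOn (I := 𝓡 m) γ X (Ioo (-ε) ε) := by
    choose U hU ε hε hγ using exists_nhds_forall_exists_isMIntegralCurveOn hX
    obtain ⟨s, hs⟩ := hK.elim_nhds_subcover U fun p _ => hU p
    have hsn : s.Nonempty := by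
      obtain ⟨p, hp, -⟩ := mem_iUnion₂.1 (hs.2 hx)
      exact ⟨p, hp⟩
    refine ⟨s.inf' hsn ε, (Finset.lt_inf'_iff _).2 fun p _ => hε p, fun y hy => ?_⟩
    obtain ⟨p, hp, hyp⟩ := mem_iUnion₂.1 (hs.2 hy)
    obtain ⟨γ, h0, h1⟩ := hγ p y hyp
    have hle : s.inf' hsn ε ≤ ε p := Finset.inf'_le _ hp
    exact ⟨γ, h0, h1.mono (Ioo_subset_Ioo (neg_le_neg hle) hle)⟩
  have hv : ContMDiff (𝓡 m) (𝓡 m).tangent 1 (fun x => (⟨x, X x⟩ : TangentBundle (𝓡 m) M)) :=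
    ContMDiff.of_le hX (by simp)
  let s := { a | ∃ γ : ℝ → M, γ 0 = x ∧ IsMIntegralCurveOn (I := 𝓡 m) γ X (Ioo (-a) a) }
  suffices hbdd : ¬BddAbove s by
    rw [not_bddAbove_iff] at hbdd
    rw [exists_isMIntegralCurve_iff_exists_isMIntegralCurveOn_Ioo hv]
    intro a
    obtain ⟨y, ⟨γ, hγ1, hγ2⟩, hlt⟩ := hbdd a
    exact ⟨γ, hγ1, hγ2.mono <| Ioo_subset_Ioo (neg_le_neg hlt.le) hlt.le⟩
  intro hbdd
  set b := sSup s with hb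
  obtain ⟨a, ha, hlt⟩ := Real.add_neg_lt_sSup (⟨ε, h x hx⟩ : Set.Nonempty s) (ε := -(ε / 2))
    (by rw [neg_lt, neg_zero]; exact half_pos hε)
  rw [← hb, ← sub_eq_add_neg] at hlt
  obtain ⟨γ, h0, hγ⟩ := ha
  have hεle : ε ≤ b := le_csSup hbdd (h x hx)
  have hγK := hinv γ a hγ (h0 ▸ hx)
  -- Restarting at the times `±(b - ε / 2)`, where `γ` is still in `K`, for a time `ε` produces a
  -- curve on `(-(b + ε / 2), b + ε / 2)`, contradicting the supremum.
  obtain ⟨γ1', h1', hγ1⟩ := h (γ (-(b - ε / 2))) (hγK _ ⟨by linarith, by linarith⟩)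
  rw [← isMIntegralCurveOn_comp_add (dt := b - ε / 2)] at hγ1
  set γ1 := γ1' ∘ (· + (b - ε / 2)) with γ1_def
  have heq1 : γ1 (-(b - ε / 2)) = γ (-(b - ε / 2)) := by simp [γ1_def, h1']
  obtain ⟨γ2', h2', hγ2⟩ := h (γ (b - ε / 2)) (hγK _ ⟨by linarith, by linarith⟩)
  rw [← isMIntegralCurveOn_comp_sub (dt := b - ε / 2)] at hγ2
  set γ2 := γ2' ∘ (· - (b - ε / 2)) with γ2_def
  have heq2 : γ2 (b - ε / 2) = γ (b - ε / 2) := by simp [γ2_def, h2']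
  simp_rw [Set.mem_Ioo, ← sub_lt_iff_lt_add, ← lt_sub_iff_add_lt, ← Set.mem_Ioo] at hγ1
  simp_rw [Set.mem_Ioo, lt_sub_iff_add_lt, sub_lt_iff_lt_add, ← Set.mem_Ioo] at hγ2
  set γe : ℝ → M := piecewise (Ioo (-(b + ε / 2)) a)
    (piecewise (Ioo (-a) a) γ γ1) γ2 with γe_def
  have heq_ext : γe 0 = x := by
    rw [γe_def, piecewise, if_pos ⟨by linarith, by linarith⟩, piecewise,
      if_pos ⟨by linarith, by linarith⟩, h0]
  suffices hext : IsMIntegralCurveOn (I := 𝓡 m) γe X (Ioo (-(b + ε / 2)) (b + ε / 2)) from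
    (not_lt.mpr <| le_csSup hbdd ⟨γe, heq_ext, hext⟩) <| lt_add_of_pos_right b (half_pos hε)
  apply (isMIntegralCurveOn_piecewise (t₀ := b - ε / 2) hv _ hγ2
      ⟨⟨by linarith, hlt⟩, ⟨by linarith, by linarith⟩⟩
      (by rw [piecewise, if_pos ⟨by linarith, hlt⟩, ← heq2])).mono
    (Ioo_subset_Ioo_union_Ioo le_rfl (by linarith) (by linarith))
  exact (isMIntegralCurveOn_piecewise (t₀ := -(b - ε / 2)) hv hγ hγ1
      ⟨⟨neg_lt_neg hlt, by linarith⟩, ⟨by linarith, by linarith⟩⟩ heq1.symm).mono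
    (union_comm _ _ ▸ Ioo_subset_Ioo_union_Ioo (by linarith) (by linarith) le_rfl)

end Completeness

/-! ### Orbits as images of the joint exponential map. -/

section Action

variable {m : ℕ} {M : Type*} [TopologicalSpace M] [ChartedSpace (EuclideanSpace ℝ (Fin m)) M]
  {ι : Type*} [Fintype ι]

theorem isMIntegralCurve_const_of_eq_zero {X : VField m M} {x : M} (h : X x = 0) :
    IsMIntegralCurve (I := 𝓡 m) (fun _ : ℝ => x) X := fun t => by
  refine (hasMFDerivAt_const x t).congr_mfderiv (ContinuousLinearMap.ext fun (c : ℝ) => ?_)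
  change 0 = c • X x
  rw [h, smul_zero]

/-- A map whose derivative is given by the vector fields `X i` maps lines to integral curves. -/
theorem isMIntegralCurve_line {X : ι → VField m M} {Φ : (ι → ℝ) → M}
    (hΦ : ∀ t, HasMFDerivAt 𝓘(ℝ, ι → ℝ) (𝓡 m) Φ t (evalMap X (Φ t))) (t s : ι → ℝ) :
    IsMIntegralCurve (I := 𝓡 m) (fun u : ℝ => Φ (t + u • s)) (comb X s) := by
  intro u
  have h1 : HasFDerivAt (fun u : ℝ => t + u • s) ((1 : ℝ →L[ℝ] ℝ).smulRight s) u := by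
    have : HasDerivAt (fun u : ℝ => t + u • s) s u := by
      simpa using ((hasDerivAt_id u).smul_const s).const_add t
    exact this.hasFDerivAt.congr_fderiv (by ext; simp)
  have h2 := (hΦ (t + u • s)).comp u (hasMFDerivAt_iff_hasFDerivAt.2 h1)
  refine h2.congr_mfderiv (ContinuousLinearMap.ext fun (c : ℝ) => ?_)
  change evalMap X (Φ (t + u • s)) (c • s) = c • comb X s (Φ (t + u • s))
  rw [map_smul, evalMap_apply]

variable [IsManifold (𝓡 m) ∞ M] [T2Space M]

theorem isMIntegralCurve_unique {X : VField m M} (hX : SmoothVField X) {γ γ' : ℝ → M}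
    (hγ : IsMIntegralCurve (I := 𝓡 m) γ X) (hγ' : IsMIntegralCurve (I := 𝓡 m) γ' X)
    (h : γ 0 = γ' 0) : γ = γ' :=
  isMIntegralCurve_Ioo_eq_of_contMDiff_boundaryless (t₀ := 0) (I := 𝓡 m)
    (ContMDiff.of_le hX (by simp)) hγ hγ' h

variable {𝒳 : Submodule ℝ (VField m M)}

/-- The map `(t i) ↦ exp (∑ t i • X i) x` of commuting complete vector fields. -/
theorem exists_hasMFDerivAt_evalMap (hs : ∀ Y ∈ 𝒳, SmoothVField Y)
    (hab : ∀ Y ∈ 𝒳, ∀ Z ∈ 𝒳, VectorField.mlieBracket (𝓡 m) Y Z = 0) {x : M}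
    (hc : ∀ Y ∈ 𝒳, ∃ γ : ℝ → M, γ 0 = x ∧ IsMIntegralCurve (I := 𝓡 m) γ Y)
    {X : ι → VField m M} (hX : ∀ i, X i ∈ 𝒳) :
    ∃ Φ : (ι → ℝ) → M, Φ 0 = x ∧
      ∀ t, HasMFDerivAt 𝓘(ℝ, ι → ℝ) (𝓡 m) Φ t (evalMap X (Φ t)) := by
  choose γ h0 hγ using fun t : ι → ℝ => hc _ (comb_mem hX t)
  refine ⟨fun t => γ t 1, ?_, fun t => hasMFDerivAt_integralCurve_coeff hs hab hX hγ h0 t⟩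
  have h1 : comb X (0 : ι → ℝ) = 0 := by simp [comb]
  have h2 : IsMIntegralCurve (I := 𝓡 m) (fun _ : ℝ => x) (comb X (0 : ι → ℝ)) :=
    isMIntegralCurve_const_of_eq_zero (by rw [h1]; rfl)
  exact congrFun (isMIntegralCurve_unique (hs _ (comb_mem hX _)) (hγ 0) h2 (h0 0)) 1

/-- A field commuting with all `X i` that vanishes at `Φ 0` vanishes on the range of `Φ`. -/
theorem eq_zero_on_range_of_eq_zero (hs : ∀ Y ∈ 𝒳, SmoothVField Y)
    (hab : ∀ Y ∈ 𝒳, ∀ Z ∈ 𝒳, VectorField.mlieBracket (𝓡 m) Y Z = 0) {x : M}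
    (hc : ∀ Y ∈ 𝒳, ∃ γ : ℝ → M, γ 0 = x ∧ IsMIntegralCurve (I := 𝓡 m) γ Y)
    {X : ι → VField m M} (hX : ∀ i, X i ∈ 𝒳) {Φ : (ι → ℝ) → M} (hΦ0 : Φ 0 = x)
    (hΦ : ∀ t, HasMFDerivAt 𝓘(ℝ, ι → ℝ) (𝓡 m) Φ t (evalMap X (Φ t)))
    {Z : VField m M} (hZ : Z ∈ 𝒳) (hZx : Z x = 0) (s : ι → ℝ) : Z (Φ s) = 0 := by
  -- `Z` is adjoined as an extra coordinate. The enlarged map `Ψ` turns out to be independent of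
  -- that coordinate, while its derivative in that direction is `Z`.
  let X' : Option ι → VField m M := fun o => o.elim Z X
  have hX' : ∀ o, X' o ∈ 𝒳 := fun o => by cases o; exacts [hZ, hX _]
  obtain ⟨Ψ, hΨ0, hΨ⟩ := exists_hasMFDerivAt_evalMap hs hab hc hX'
  let c : ℝ → (ι → ℝ) → Option ι → ℝ := fun b t o => o.elim b t
  have hcomb : ∀ b t, comb X' (c b t) = b • Z + comb X t := fun b t => by
    simp [comb, Fintype.sum_option, X', c]
  have hadd : ∀ b t b' t', c b t + c b' t' = c (b + b') (t + t') := fun b t b' t' => by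
    ext o; cases o <;> rfl
  have hsmul : ∀ (u b : ℝ) t, u • c b t = c (u * b) (u • t) := fun u b t => by
    ext o; cases o <;> rfl
  have hc0 : c 0 0 = 0 := by ext o; cases o <;> rfl
  have h1 : ∀ b, Ψ (c b 0) = x := fun b => by
    have e1 := isMIntegralCurve_line hΨ 0 (c b 0)
    have e2 : IsMIntegralCurve (I := 𝓡 m) (fun _ : ℝ => x) (comb X' (c b 0)) :=
      isMIntegralCurve_const_of_eq_zero (by rw [hcomb]; simp [hZx, comb])
    have := congrFun (isMIntegralCurve_unique (hs _ (comb_mem hX' _)) e1 e2 (by simpa using hΨ0)) 1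
    simpa using this
  -- Moving along `Z` first does not leave `x`; moving then along `comb X s` reaches `Φ s`.
  have h2 : ∀ b, Ψ (c b s) = Φ s := fun b => by
    have e1 := isMIntegralCurve_line hΨ (c b 0) (c 0 s)
    have e2 := isMIntegralCurve_line hΦ 0 s
    rw [hcomb, zero_smul, zero_add] at e1
    have := congrFun (isMIntegralCurve_unique (hs _ (comb_mem hX _)) e1 e2
      (by simp [h1, hΦ0])) 1
    simpa [hadd] using this
  have e1 := isMIntegralCurve_line hΨ (c 0 s) (c 1 0)
  have e2 : (fun u : ℝ => Ψ (c 0 s + u • c 1 0)) = fun _ => Φ s := by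
    funext u; rw [hsmul, hadd]; simp [h2]
  have e3 : comb X' (c 1 0) = Z := by rw [hcomb]; simp [comb]
  rw [e2, e3] at e1
  have := hasMFDerivAt_unique (e1 0) (hasMFDerivAt_const (Φ s) (0 : ℝ))
  have : (1 : ℝ) • Z (Φ s) = 0 := DFunLike.congr_fun this (1 : ℝ)
  rwa [one_smul] at this

/-- If the `X i` span the values of `𝒳` at `x`, the orbit of `x` is the range of `Φ`. -/
theorem orbit_subset_range (hs : ∀ Y ∈ 𝒳, SmoothVField Y)
    (hab : ∀ Y ∈ 𝒳, ∀ Z ∈ 𝒳, VectorField.mlieBracket (𝓡 m) Y Z = 0) {x : M}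
    (hc : ∀ Y ∈ 𝒳, ∃ γ : ℝ → M, γ 0 = x ∧ IsMIntegralCurve (I := 𝓡 m) γ Y)
    {X : ι → VField m M} (hX : ∀ i, X i ∈ 𝒳) (hspan : ∀ Y ∈ 𝒳, ∃ s, comb X s x = Y x)
    {Φ : (ι → ℝ) → M} (hΦ0 : Φ 0 = x)
    (hΦ : ∀ t, HasMFDerivAt 𝓘(ℝ, ι → ℝ) (𝓡 m) Φ t (evalMap X (Φ t))) :
    orbit 𝒳 x ⊆ range Φ := by
  intro y hy
  induction hy with
  | refl => exact ⟨0, hΦ0⟩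
  | tail _ hstep ih =>
    obtain ⟨t, rfl⟩ := ih
    obtain ⟨Y, hY, γ, hγ, h0, rfl⟩ := hstep
    obtain ⟨s, hsY⟩ := hspan Y hY
    -- The coefficients `s` found at `x` remain valid at every point of the range, so `Y` follows
    -- straight lines in the `t`-space.
    have hYΦ : ∀ r, Y (Φ r) = comb X s (Φ r) := fun r => by
      have := eq_zero_on_range_of_eq_zero hs hab hc hX hΦ0 hΦ
        (𝒳.sub_mem hY (comb_mem hX s)) (by simp [hsY]) r
      exact sub_eq_zero.1 this
    have hline : IsMIntegralCurve (I := 𝓡 m) (fun u : ℝ => Φ (t + u • s)) Y := fun u => by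
      have := isMIntegralCurve_line hΦ t s u
      rwa [← hYΦ] at this
    set c : ℝ → M := fun u => Φ (t + u • s) with hc_def
    have hc0 : c 0 = γ 0 := by simp [hc_def, h0]
    -- Uniqueness is applied on an open interval, whereas `γ` is controlled only on `[0, 1]`: the
    -- line `c` continues it to negative times, and time 1 is reached afterwards by continuity.
    let δ : ℝ → M := fun u => if u < 0 then c u else γ u
    have hδγ : ∀ u, 0 ≤ u → δ u = γ u := fun u hu => if_neg (not_lt.2 hu)
    have hδc : ∀ u, u ≤ 0 → δ u = c u := fun u hu => by
      rcases hu.lt_or_eq with h | rfl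
      · exact if_pos h
      · rw [hδγ 0 le_rfl, hc0]
    have hδ : IsMIntegralCurveOn (I := 𝓡 m) δ Y (Ioo (-1) 1) := by
      intro u hu
      refine HasMFDerivAt.hasMFDerivWithinAt ?_
      have hR : 0 ≤ u →
          HasMFDerivWithinAt 𝓘(ℝ, ℝ) (𝓡 m) δ (Ici 0) u ((1 : ℝ →L[ℝ] ℝ).smulRight (Y (δ u))) := by
        intro hu0
        have h1 := hγ u ⟨hu0, hu.2.le⟩
        rw [← hδγ u hu0] at h1
        have h2 := (h1.mono_of_mem_nhdsWithin (s := Icc 0 1) (t := Ici 0) ?_)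
        · exact h2.congr_mono (fun v hv => hδγ v hv) (hδγ u hu0) Subset.rfl
        · rw [← Ici_inter_Iic]
          exact Filter.inter_mem self_mem_nhdsWithin
            (mem_nhdsWithin_of_mem_nhds (Iic_mem_nhds hu.2))
      have hL : u ≤ 0 →
          HasMFDerivWithinAt 𝓘(ℝ, ℝ) (𝓡 m) δ (Iic 0) u ((1 : ℝ →L[ℝ] ℝ).smulRight (Y (δ u))) := by
        intro hu0
        have h1 := (hline u).hasMFDerivWithinAt (s := Iic 0)
        rw [← hδc u hu0] at h1
        exact h1.congr_mono (fun v hv => hδc v hv) (hδc u hu0) Subset.rfl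
      rcases lt_trichotomy u 0 with h | rfl | h
      · exact (hL h.le).hasMFDerivAt (Iic_mem_nhds h)
      · have := (hL le_rfl).union (hR le_rfl)
        rw [Iic_union_Ici] at this
        exact hasMFDerivWithinAt_univ.1 this
      · exact (hR h.le).hasMFDerivAt (Ici_mem_nhds h)
    have heq : EqOn δ c (Ioo (-1) 1) :=
      isMIntegralCurveOn_Ioo_eqOn_of_contMDiff_boundaryless (t₀ := 0) (I := 𝓡 m)
        ⟨by norm_num, by norm_num⟩ (ContMDiff.of_le (hs Y hY) (by simp)) hδ
        (hline.isMIntegralCurveOn _) (hδc 0 le_rfl)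
    have heq' : EqOn γ c (Ico 0 1) := fun u hu => by
      rw [← heq ⟨by linarith [hu.1], hu.2⟩, hδγ u hu.1]
    have hcl : γ 1 = c 1 := by
      have h1 : Filter.Tendsto γ (𝓝[Ico 0 1] 1) (𝓝 (γ 1)) :=
        (hγ.continuousWithinAt ⟨zero_le_one, le_rfl⟩).mono Ico_subset_Icc_self
      have h2 : Filter.Tendsto c (𝓝[Ico 0 1] 1) (𝓝 (c 1)) :=
        hline.continuous.continuousAt.continuousWithinAt
      have : (𝓝[Ico (0 : ℝ) 1] 1).NeBot := by
        rw [← mem_closure_iff_nhdsWithin_neBot, closure_Ico zero_ne_one]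
        exact ⟨zero_le_one, le_rfl⟩
      exact tendsto_nhds_unique (h1.congr' heq'.eventuallyEq_nhdsWithin) h2
    exact ⟨t + (1 : ℝ) • s, hcl.symm⟩

end Action

/-! ### Dimension bound for a covered fiber. -/

section Dimension

open Metric MeasureTheory Module

/-- A differentiable map does not raise dimension: its image has empty interior if the dimension
of the target is larger than that of the source. -/
theorem interior_image_eq_empty_of_finrank_lt {E F : Type*} [NormedAddCommGroup E]
    [NormedSpace ℝ E] [FiniteDimensional ℝ E] [NormedAddCommGroup F] [NormedSpace ℝ F]
    [FiniteDimensional ℝ F] (hEF : finrank ℝ E < finrank ℝ F) {g : E → F} {S : Set E}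
    (hg : DifferentiableOn ℝ g S) : interior (g '' S) = ∅ := by
  borelize F
  -- Placing `E` inside `F` as a proper, hence null, subspace writes `g` as a differentiable map
  -- between sets in `F`, and such maps preserve null sets.
  obtain ⟨i, hi⟩ := finrank_le_iff_exists_linearMap.1 hEF.le
  obtain ⟨P, hP⟩ := i.exists_leftInverse_of_injective (LinearMap.ker_eq_bot.2 hi)
  have hPi : ∀ e, P (i e) = e := fun e => LinearMap.congr_fun hP e
  let P' : F →L[ℝ] E := LinearMap.toContinuousLinearMap P
  have hS : (μ : Measure F) → [μ.IsAddHaarMeasure] → μ (i '' S) = 0 := fun μ _ => by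
    refine measure_mono_null ?_ (Measure.addHaar_submodule μ (LinearMap.range i) fun h => ?_)
    · rintro _ ⟨e, -, rfl⟩; exact ⟨e, rfl⟩
    · have := LinearMap.finrank_range_le i
      rw [h, finrank_top] at this
      omega
  have himg : g '' S = (g ∘ P') '' (i '' S) := by
    rw [image_image]
    exact image_congr fun e _ => congrArg g (hPi e).symm
  have hd : DifferentiableOn ℝ (g ∘ P') (i '' S) := by
    refine hg.comp P'.differentiable.differentiableOn ?_
    rintro _ ⟨e, he, rfl⟩
    change P (i e) ∈ S
    rwa [hPi]
  have := addHaar_image_eq_zero_of_differentiableOn_of_addHaar_eq_zero Measure.addHaar hd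
    (hS Measure.addHaar)
  rw [himg]
  exact Measure.interior_eq_empty_of_null this

variable {m p : ℕ} {M : Type*} [TopologicalSpace M] [ChartedSpace (EuclideanSpace ℝ (Fin m)) M]
  {W : Type*} [TopologicalSpace W] [ChartedSpace (EuclideanSpace ℝ (Fin p)) W]

/-- If the component of a fiber of a submersion is covered by a differentiable map from `ℝ^ι`, its
dimension is at most the cardinality of `ι`. -/
theorem finrank_vertical_le_card {π : M → W} {x : M}
    (hπ : Manifold.IsSubmersionAt (𝓡 m) (𝓡 p) ∞ π x) {ι : Type*} [Fintype ι] {Φ : (ι → ℝ) → M}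
    (hΦ : ∀ t, MDifferentiableAt 𝓘(ℝ, ι → ℝ) (𝓡 m) Φ t)
    (hrange : connectedComponentIn (π ⁻¹' {π x}) x ⊆ range Φ) :
    finrank ℝ (vertical (p := p) π x : Submodule ℝ (TangentSpace (𝓡 m) x)) ≤ Fintype.card ι := by
  obtain ⟨F, _, _, hπ⟩ := hπ
  obtain ⟨e, c, hxe, hxc, he, hc, hec, L, hL⟩ := hπ
  have : FiniteDimensional ℝ F :=
    Module.Finite.of_surjective ((LinearMap.snd ℝ (EuclideanSpace ℝ (Fin p)) F).comp
      L.toLinearEquiv.toLinearMap) (Prod.snd_surjective.comp L.surjective)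
  set φ := e.extend (𝓡 m) with hφ
  set ψ := c.extend (𝓡 p) with hψ
  have hφs : φ.source = e.source := e.extend_source
  have hψs : ψ.source = c.source := c.extend_source
  have hφT : IsOpen φ.target := e.isOpen_extend_target
  have hxφ : x ∈ φ.source := hφs ▸ hxe
  have hloc : ∀ y ∈ φ.source, ψ (π y) = (L (φ y)).1 := fun y hy => by
    have := hL (φ.map_source hy)
    simpa [φ.left_inv hy] using this
  -- the fiber direction of the chart is injective on the vertical space
  have hle : finrank ℝ (vertical (p := p) π x : Submodule ℝ (TangentSpace (𝓡 m) x)) ≤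
      finrank ℝ F := by
    have hφd : HasMFDerivAt (𝓡 m) 𝓘(ℝ, EuclideanSpace ℝ (Fin m)) φ x
        (mfderiv (𝓡 m) 𝓘(ℝ, EuclideanSpace ℝ (Fin m)) φ x) :=
      ((e.contMDiffAt_extend he hxe).mdifferentiableAt (by simp)).hasMFDerivAt
    have hψd : HasMFDerivAt (𝓡 p) 𝓘(ℝ, EuclideanSpace ℝ (Fin p)) ψ (π x)
        (mfderiv (𝓡 p) 𝓘(ℝ, EuclideanSpace ℝ (Fin p)) ψ (π x)) :=
      ((c.contMDiffAt_extend hc hxc).mdifferentiableAt (by simp)).hasMFDerivAt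
    have hπd : HasMFDerivAt (𝓡 m) (𝓡 p) π x (mfderiv (𝓡 m) (𝓡 p) π x) := by
      have h1 : Manifold.IsSubmersionAtOfComplement F (𝓡 m) (𝓡 p) ∞ π x :=
        ⟨e, c, hxe, hxc, he, hc, hec, L, hL⟩
      exact (h1.contMDiffAt.mdifferentiableAt (by simp)).hasMFDerivAt
    have hsymm : HasMFDerivAt 𝓘(ℝ, EuclideanSpace ℝ (Fin m)) (𝓡 m) φ.symm (φ x)
        (mfderiv 𝓘(ℝ, EuclideanSpace ℝ (Fin m)) (𝓡 m) φ.symm (φ x)) := by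
      have h1 := contMDiffOn_extend_symm he
      rw [← e.extend_target'] at h1
      exact ((h1.contMDiffAt (hφT.mem_nhds (φ.map_source hxφ))).mdifferentiableAt
        (by simp)).hasMFDerivAt
    set D : TangentSpace (𝓡 m) x →L[ℝ] EuclideanSpace ℝ (Fin m) :=
      mfderiv (𝓡 m) 𝓘(ℝ, EuclideanSpace ℝ (Fin m)) φ x with hD
    have hev : ∀ᶠ y in 𝓝 x, y ∈ φ.source := by
      rw [hφs]; exact e.open_source.mem_nhds hxe
    have hDinj : ∀ v, D v = 0 → v = 0 := by
      intro v hv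
      have h1 := hsymm.comp x hφd
      have h2 : φ.symm ∘ φ =ᶠ[𝓝 x] id := hev.mono fun y hy => φ.left_inv hy
      have h3 := hasMFDerivAt_unique h1 ((hasMFDerivAt_id x).congr_of_eventuallyEq h2)
      have h4 : (mfderiv 𝓘(ℝ, EuclideanSpace ℝ (Fin m)) (𝓡 m) φ.symm (φ x)) (D v) = v :=
        DFunLike.congr_fun h3 v
      rw [← h4, hv]
      have h5 : ∀ A : EuclideanSpace ℝ (Fin m) →L[ℝ] EuclideanSpace ℝ (Fin m), A 0 = 0 :=
        fun A => map_zero A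
      exact h5 _
    have hfst : ∀ v, mfderiv (𝓡 m) (𝓡 p) π x v = 0 → (L (D v)).1 = 0 := by
      intro v hv
      have h1 := hψd.comp x hπd
      have h2 : HasMFDerivAt 𝓘(ℝ, EuclideanSpace ℝ (Fin m)) 𝓘(ℝ, EuclideanSpace ℝ (Fin p))
          (fun z => (L z).1) (φ x)
          ((ContinuousLinearMap.fst ℝ (EuclideanSpace ℝ (Fin p)) F).comp
            (L : EuclideanSpace ℝ (Fin m) →L[ℝ] EuclideanSpace ℝ (Fin p) × F)) :=
        hasMFDerivAt_iff_hasFDerivAt.2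
          ((ContinuousLinearMap.fst ℝ (EuclideanSpace ℝ (Fin p)) F).comp
            (L : EuclideanSpace ℝ (Fin m) →L[ℝ] EuclideanSpace ℝ (Fin p) × F)).hasFDerivAt
      have h3 := h2.comp x hφd
      have h4 : (ψ ∘ π) =ᶠ[𝓝 x] (fun z => (L z).1) ∘ φ := hev.mono hloc
      have h5 := hasMFDerivAt_unique h1 (h3.congr_of_eventuallyEq h4)
      have h6 : mfderiv (𝓡 p) 𝓘(ℝ, EuclideanSpace ℝ (Fin p)) ψ (π x)
          (mfderiv (𝓡 m) (𝓡 p) π x v) = (L (D v)).1 := DFunLike.congr_fun h5 v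
      rw [← h6, hv]
      have h7 : ∀ A : EuclideanSpace ℝ (Fin p) →L[ℝ] EuclideanSpace ℝ (Fin p), A 0 = 0 :=
        fun A => map_zero A
      exact h7 _
    let T : (vertical (p := p) π x : Submodule ℝ (TangentSpace (𝓡 m) x)) →ₗ[ℝ] F :=
      (((ContinuousLinearMap.snd ℝ (EuclideanSpace ℝ (Fin p)) F).comp
        ((L : EuclideanSpace ℝ (Fin m) →L[ℝ] EuclideanSpace ℝ (Fin p) × F).comp D)) :
          TangentSpace (𝓡 m) x →ₗ[ℝ] F).comp (Submodule.subtype _)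
    refine LinearMap.finrank_le_finrank_of_injective (f := T) ?_
    rw [← LinearMap.ker_eq_bot, LinearMap.ker_eq_bot']
    rintro ⟨v, hv⟩ hT
    have h1 : (L (D v)).2 = 0 := hT
    have h2 : L (D v) = 0 := Prod.ext (hfst v hv) h1
    exact Subtype.ext (hDinj v (L.map_eq_zero_iff.1 h2))
  refine hle.trans ?_
  by_contra! hlt
  -- the slice through `x` is covered by the image of `Φ`
  set g : (ι → ℝ) → F := fun t => (L (φ (Φ t))).2 with hg
  have hgd : DifferentiableOn ℝ g (Φ ⁻¹' e.source) := by
    intro t ht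
    have h1 : MDifferentiableAt (𝓡 m) 𝓘(ℝ, EuclideanSpace ℝ (Fin m)) φ (Φ t) :=
      (e.contMDiffAt_extend he ht).mdifferentiableAt (by simp)
    have h2 : DifferentiableAt ℝ (fun t => φ (Φ t)) t :=
      mdifferentiableAt_iff_differentiableAt.1 (h1.comp t (hΦ t))
    exact ((L.differentiableAt.comp t h2).snd).differentiableWithinAt
  have hempty := interior_image_eq_empty_of_finrank_lt (by simpa using hlt) hgd
  set a := (L (φ x)).1 with ha
  set b := (L (φ x)).2 with hb
  have hcont : Continuous fun f : F => L.symm (a, f) := by fun_prop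
  have hLb : L.symm (a, b) = φ x := by
    rw [ha, hb]; exact L.symm_apply_apply _
  obtain ⟨δ, hδ, hball⟩ := Metric.mem_nhds_iff.1
    (hcont.continuousAt.preimage_mem_nhds (x := b)
      (hφT.mem_nhds (by rw [hLb]; exact φ.map_source hxφ)))
  -- In these charts `π` is a projection, so `σ` parametrises the piece of the fiber through `x`;
  -- being connected, it lies in the component of `x`.
  set σ : F → M := fun f => φ.symm (L.symm (a, f)) with hσ
  have hσs : ∀ f ∈ ball b δ, σ f ∈ φ.source := fun f hf => φ.map_target (hball hf)
  have hφσ : ∀ f ∈ ball b δ, L (φ (σ f)) = (a, f) := fun f hf => by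
    rw [hσ]
    simp only
    rw [φ.right_inv (hball hf), L.apply_symm_apply]
  have hσc : ContinuousOn σ (ball b δ) := by
    have h1 : ContinuousOn φ.symm φ.target := e.continuousOn_extend_symm
    exact h1.comp hcont.continuousOn hball
  have hσb : σ b = x := by
    simp only [hσ, hLb]; exact φ.left_inv hxφ
  have hσπ : σ '' ball b δ ⊆ π ⁻¹' {π x} := by
    rintro _ ⟨f, hf, rfl⟩
    have h1 : ψ (π (σ f)) = ψ (π x) := by
      rw [hloc _ (hσs f hf), hloc x hxφ, hφσ f hf]
    refine ψ.injOn ?_ ?_ h1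
    · rw [hψs]; exact hec (hφs ▸ hσs f hf)
    · rw [hψs]; exact hxc
  have hσr : σ '' ball b δ ⊆ range Φ := by
    refine Subset.trans ?_ hrange
    exact ((convex_ball b δ).isPreconnected.image σ hσc).subset_connectedComponentIn
      ⟨b, mem_ball_self hδ, hσb⟩ hσπ
  have hsub : ball b δ ⊆ g '' (Φ ⁻¹' e.source) := by
    intro f hf
    obtain ⟨t, ht⟩ := hσr ⟨f, hf, rfl⟩
    refine ⟨t, ?_, ?_⟩
    · rw [mem_preimage, ht, ← hφs]; exact hσs f hf
    · simp only [hg]; rw [ht, hφσ f hf]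
  have := interior_mono hsub
  rw [hempty, isOpen_ball.interior_eq] at this
  exact this (mem_ball_self hδ)

end Dimension

/-! ### The fields of `𝒳` span the vertical spaces. -/

section Spanning

open Module

variable {n p : ℕ}
    {M : Type*} [TopologicalSpace M]
    [ChartedSpace (EuclideanSpace ℝ (Fin (2 * n + 1))) M] [IsManifold (𝓡 (2 * n + 1)) ∞ M]
    {W : Type*} [TopologicalSpace W]
    [ChartedSpace (EuclideanSpace ℝ (Fin p)) W]
    {ξ : Distribution (2 * n + 1) M} {𝒳 : Submodule ℝ (VField (2 * n + 1) M)} {π : M → W}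

namespace IsCompletePreIsotropic


/-- Orbits use curves parametrised by `[0, 1]`; replacing `X` by `t • X` rescales time and also
covers negative `t`. -/
theorem map_eq_of_isMIntegralCurveOn (h : IsCompletePreIsotropic (p := p) ξ 𝒳 π)
    {X : VField (2 * n + 1) M} (hX : X ∈ 𝒳) {γ : ℝ → M} {a : ℝ}
    (hγ : IsMIntegralCurveOn (I := 𝓡 (2 * n + 1)) γ X (Ioo (-a) a)) {t : ℝ}
    (ht : t ∈ Ioo (-a) a) : π (γ t) = π (γ 0) := by
  have h1 := hγ.comp_mul t
  have h2 : γ t ∈ orbit 𝒳 (γ 0) := by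
    refine Relation.ReflTransGen.single ⟨t • X, 𝒳.smul_mem t hX, γ ∘ (· * t), h1.mono ?_, ?_, ?_⟩
    · intro u hu
      change u * t ∈ Ioo (-a) a
      have h3 : |u * t| < a := by
        rw [abs_mul]
        have h4 : |u| ≤ 1 := abs_le.2 ⟨by linarith [hu.1], hu.2⟩
        have h5 : |t| < a := abs_lt.2 ht
        nlinarith [abs_nonneg t, abs_nonneg u]
      exact abs_lt.1 h3
    · simp
    · simp
  rw [h.orbit_eq] at h2
  have h3 : γ t ∈ π ⁻¹' {π (γ 0)} := connectedComponentIn_subset _ _ h2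
  exact h3

variable [T2Space M]

/-- Integral curves stay in their fiber, which is compact because `π` is proper. -/
theorem exists_isMIntegralCurve (h : IsCompletePreIsotropic (p := p) ξ 𝒳 π)
    {X : VField (2 * n + 1) M} (hX : X ∈ 𝒳) (x : M) :
    ∃ γ : ℝ → M, γ 0 = x ∧ IsMIntegralCurve (I := 𝓡 (2 * n + 1)) γ X := by
  refine exists_isMIntegralCurve_of_isCompact (h.contact_vfield X hX).smooth
    (h.proper.isCompact_preimage (isCompact_singleton (x := π x))) ?_ rfl
  intro γ a hγ h0 t ht
  exact (h.map_eq_of_isMIntegralCurveOn hX hγ ht).trans h0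

theorem apply_mem_vertical (h : IsCompletePreIsotropic (p := p) ξ 𝒳 π)
    {X : VField (2 * n + 1) M} (hX : X ∈ 𝒳) (x : M) : X x ∈ vertical (p := p) π x := by
  obtain ⟨γ, rfl, hγ⟩ := h.exists_isMIntegralCurve hX x
  have hπ : HasMFDerivAt (𝓡 (2 * n + 1)) (𝓡 p) π (γ 0)
      (mfderiv (𝓡 (2 * n + 1)) (𝓡 p) π (γ 0)) :=
    ((h.submersion.isSubmersionAt (γ 0)).contMDiffAt.mdifferentiableAt (by simp)).hasMFDerivAt
  have h1 := hπ.comp (0 : ℝ) (hγ 0)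
  have h2 : π ∘ γ = fun _ => π (γ 0) := funext fun t =>
    h.map_eq_of_isMIntegralCurveOn hX (a := |t| + 1) (hγ.isMIntegralCurveOn _)
      (abs_lt.1 (lt_add_one _))
  have h3 : HasMFDerivAt 𝓘(ℝ, ℝ) (𝓡 p) (π ∘ γ) (0 : ℝ)
      (0 : ℝ →L[ℝ] EuclideanSpace ℝ (Fin p)) := by
    rw [h2]; exact hasMFDerivAt_const (π (γ 0)) (0 : ℝ)
  have h4 := DFunLike.congr_fun (hasMFDerivAt_unique h1 h3) (1 : ℝ)
  have h5 : mfderiv (𝓡 (2 * n + 1)) (𝓡 p) π (γ 0) ((1 : ℝ) • X (γ 0)) = 0 := h4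
  rw [one_smul] at h5
  exact h5

/-- The elements of `𝒳` span the tangent spaces of the fibers. -/
theorem exists_apply_eq (h : IsCompletePreIsotropic (p := p) ξ 𝒳 π) {x : M}
    {v : TangentSpace (𝓡 (2 * n + 1)) x} (hv : v ∈ vertical (p := p) π x) :
    ∃ X ∈ 𝒳, X x = v := by
  let ev : VField (2 * n + 1) M →ₗ[ℝ] TangentSpace (𝓡 (2 * n + 1)) x := LinearMap.proj x
  let S : Submodule ℝ (TangentSpace (𝓡 (2 * n + 1)) x) := 𝒳.map ev
  have : FiniteDimensional ℝ (TangentSpace (𝓡 (2 * n + 1)) x) :=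
    inferInstanceAs (FiniteDimensional ℝ (EuclideanSpace ℝ (Fin (2 * n + 1))))
  have hS : S ≤ vertical (p := p) π x := by
    rintro _ ⟨X, hX, rfl⟩
    exact h.apply_mem_vertical hX x
  let b := Module.finBasis ℝ S
  choose X hX hXb using fun i => (b i).2
  have hs : ∀ Y ∈ 𝒳, SmoothVField Y := fun Y hY => (h.contact_vfield Y hY).smooth
  have hc := fun Y hY => h.exists_isMIntegralCurve (X := Y) hY x
  obtain ⟨Φ, hΦ0, hΦ⟩ := exists_hasMFDerivAt_evalMap hs h.abelian hc hX
  have hspan : ∀ Y ∈ 𝒳, ∃ s, comb X s x = Y x := by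
    intro Y hY
    refine ⟨fun i => b.repr ⟨Y x, Y, hY, rfl⟩ i, ?_⟩
    have h1 := congrArg Subtype.val (b.sum_repr ⟨Y x, Y, hY, rfl⟩)
    simp only [Submodule.coe_sum, Submodule.coe_smul] at h1
    simp only [comb, Finset.sum_apply, Pi.smul_apply]
    refine Eq.trans (Finset.sum_congr rfl fun i _ => ?_) h1
    exact congrArg _ (hXb i)
  have hrange : connectedComponentIn (π ⁻¹' {π x}) x ⊆ range Φ := by
    rw [← h.orbit_eq]
    exact orbit_subset_range hs h.abelian hc hX hspan hΦ0 hΦ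
  -- The index type has as many elements as `S` has dimensions, so the covering of the component
  -- leaves no room for `S` to be proper.
  have hle := finrank_vertical_le_card (h.submersion.isSubmersionAt x)
    (fun t => (hΦ t).mdifferentiableAt) hrange
  rw [Fintype.card_fin] at hle
  have heq : S = vertical (p := p) π x := Submodule.eq_of_le_of_finrank_le hS hle
  rw [← heq] at hv
  exact hv

/-- Otherwise spanning would put the vertical space inside `ξ x`, and transversality would make `ξ
x` the whole tangent space, although a contact form does not vanish. -/
theorem exists_apply_notMem (h : IsCompletePreIsotropic (p := p) ξ 𝒳 π) (x : M) :
    ∃ X ∈ 𝒳, X x ∉ ξ x := by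
  by_contra! hcon
  have h1 : vertical (p := p) π x ≤ ξ x := fun v hv => by
    obtain ⟨X, hX, rfl⟩ := h.exists_apply_eq hv
    exact hcon X hX
  have h2 : ξ x = ⊤ := by rw [← h.transversal x, sup_eq_right.2 h1]
  obtain ⟨U, hxU, α, hα⟩ := h.contact x
  refine hα.contact.ne_zero x hxU (ContinuousLinearMap.ext fun v => ?_)
  exact (hα.mem_iff x hxU v).1 (h2 ▸ Submodule.mem_top)

end IsCompletePreIsotropic

end Spanning

/-! ### Calculus of 1-forms and the local normalisation. -/

section PfaffianForms

variable {m : ℕ} {M : Type*} [TopologicalSpace M] [ChartedSpace (EuclideanSpace ℝ (Fin m)) M]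

/-- The differential of a function, as a linear form on the tangent space. -/
def dFun (g : M → ℝ) (x : M) : TangentSpace (𝓡 m) x →L[ℝ] ℝ := mfderiv (𝓡 m) 𝓘(ℝ, ℝ) g x

theorem eventually_inChart_eq {α β : OneForm m M} {x : M} (h : ∀ᶠ y in 𝓝 x, α y = β y) :
    inChart α x =ᶠ[𝓝 (extChartAt (𝓡 m) x x)] inChart β x := by
  have h1 := (continuousAt_extChartAt_symm (I := 𝓡 m) x).tendsto
  rw [extChartAt_to_inv] at h1
  filter_upwards [h1.eventually h] with z hz
  simp only [inChart, hz]

theorem extD_congr {α β : OneForm m M} {x : M} (h : ∀ᶠ y in 𝓝 x, α y = β y)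
    (u v : TangentSpace (𝓡 m) x) : extD α x u v = extD β x u v := by
  simp only [extD, (eventually_inChart_eq h).fderiv_eq]

theorem lieD_congr {α β : OneForm m M} {x : M} (h : ∀ᶠ y in 𝓝 x, α y = β y) (X : VField m M)
    (v : TangentSpace (𝓡 m) x) : lieD X α x v = lieD X β x v := by
  have h1 : (fun y => α y (X y)) =ᶠ[𝓝 x] fun y => β y (X y) := h.mono fun y hy => by
    simp only [hy]
  simp only [lieD, extD_congr h, h1.mfderiv_eq]

variable [IsManifold (𝓡 m) ∞ M]

theorem inChart_chartField (α : OneForm m M) (X : VField m M) {x : M}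
    {z : EuclideanSpace ℝ (Fin m)} (hz : z ∈ (extChartAt (𝓡 m) x).target) :
    inChart α x z (chartField x X z) =
      α ((extChartAt (𝓡 m) x).symm z) (X ((extChartAt (𝓡 m) x).symm z)) := by
  rw [← dChartSymm_chartField X hz]
  rfl

theorem inChart_dChart (α : OneForm m M) {x : M} (v : TangentSpace (𝓡 m) x) :
    inChart α x (extChartAt (𝓡 m) x x) (dChart x x v) = α x v := by
  let X : VField m M := fun _ => (show EuclideanSpace ℝ (Fin m) from v)
  have h1 := inChart_chartField α X (mem_extChartAt_target (I := 𝓡 m) x)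
  rw [chartField_apply X (mem_extChartAt_source (I := 𝓡 m) x), extChartAt_to_inv] at h1
  exact h1

/-- The inverse of the tangent bundle trivialisation is the derivative of the inverse chart, so the
bundle coordinates of `α` are its pullback `inChart`. -/
theorem contDiffAt_inChart {U : Set M} (hU : IsOpen U) {α : OneForm m M} (hα : SmoothFormOn U α)
    {x : M} (hx : x ∈ U) : ContDiffAt ℝ ∞ (inChart α x) (extChartAt (𝓡 m) x x) := by
  set φ := extChartAt (𝓡 m) x with hφ
  have h1 := ((contMDiffAt_hom_bundle _).1 (hα.contMDiffAt (hU.mem_nhds hx))).2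
  have hz : φ x ∈ φ.target := mem_extChartAt_target x
  have hx' : φ.symm (φ x) = x := extChartAt_to_inv x
  have h2 := ContMDiffAt.comp_of_eq (f := φ.symm) h1 (contMDiffAt_extChartAt_symm hz) hx'
  rw [← contMDiffAt_iff_contDiffAt]
  refine h2.congr_of_eventuallyEq ?_
  filter_upwards [(isOpen_extChartAt_target x).mem_nhds hz] with z hz
  have h3 : φ.symm z ∈ (chartAt (EuclideanSpace ℝ (Fin m)) x).source := by
    rw [← extChartAt_source (𝓡 m)]; exact φ.map_target hz
  refine ContinuousLinearMap.ext fun e => ?_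
  have h4 := TangentBundle.symmL_trivializationAt (I := 𝓡 m) h3
  rw [modelWithCornersSelf_coe, range_id, mfderivWithin_univ, φ.right_inv hz] at h4
  simp only [Function.comp_apply, ContinuousLinearMap.inCoordinates]
  have h5 : ∀ r : ℝ, (trivializationAt ℝ (Bundle.Trivial M ℝ) x).continuousLinearMapAt ℝ
      (φ.symm z) r = r := fun r =>
    DFunLike.congr_fun (Bundle.Trivial.continuousLinearMapAt_trivialization ℝ M ℝ (φ.symm z)) r
  exact (congrArg (fun A : EuclideanSpace ℝ (Fin m) →L[ℝ] EuclideanSpace ℝ (Fin m) =>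
    (α (φ.symm z) : EuclideanSpace ℝ (Fin m) →L[ℝ] ℝ) (A e)) h4.symm).trans (h5 _).symm

theorem contMDiffOn_apply {U : Set M} {α : OneForm m M} (hα : SmoothFormOn U α) {X : VField m M}
    (hX : SmoothVField X) : ContMDiffOn (𝓡 m) 𝓘(ℝ, ℝ) ∞ (fun y => α y (X y)) U := by
  have h1 := ContMDiffOn.clm_bundle_apply hα (hX.contMDiffOn (s := U))
  intro y hy
  exact ((Bundle.contMDiffWithinAt_totalSpace).1 (h1 y hy)).2

theorem SmoothFormOn.smul {U : Set M} {α : OneForm m M} (hα : SmoothFormOn U α) {g : M → ℝ}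
    (hg : ContMDiffOn (𝓡 m) 𝓘(ℝ, ℝ) ∞ g U) : SmoothFormOn U fun y => g y • α y :=
  ContMDiffOn.smul_section hg hα

/-- The product rule for the coordinate expression of a form. -/
theorem fderiv_inChart_smul {U : Set M} (hU : IsOpen U) {α : OneForm m M} (hα : SmoothFormOn U α)
    {g : M → ℝ} {x : M} (hx : x ∈ U) (hg : MDifferentiableAt (𝓡 m) 𝓘(ℝ, ℝ) g x)
    (u : TangentSpace (𝓡 m) x) (e : EuclideanSpace ℝ (Fin m)) :
    fderiv ℝ (inChart (fun y => g y • α y) x) (extChartAt (𝓡 m) x x) (dChart x x u) e =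
      g x * fderiv ℝ (inChart α x) (extChartAt (𝓡 m) x x) (dChart x x u) e +
        dFun g x u * inChart α x (extChartAt (𝓡 m) x x) e := by
  set φ := extChartAt (𝓡 m) x with hφ
  have hz : φ x ∈ φ.target := mem_extChartAt_target x
  have hx' : φ.symm (φ x) = x := extChartAt_to_inv x
  have hd : DifferentiableAt ℝ (inChart α x) (φ x) :=
    (contDiffAt_inChart hU hα hx).differentiableAt (by simp)
  have hgd : HasMFDerivAt 𝓘(ℝ, EuclideanSpace ℝ (Fin m)) 𝓘(ℝ, ℝ) (g ∘ φ.symm) (φ x)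
      ((mfderiv (𝓡 m) 𝓘(ℝ, ℝ) g x : TangentSpace (𝓡 m) x →L[ℝ] ℝ).comp
        (dChartSymm x (φ x) : EuclideanSpace ℝ (Fin m) →L[ℝ] EuclideanSpace ℝ (Fin m))) := by
    refine HasMFDerivAt.comp (φ x) (I' := 𝓡 m) ?_ ?_
    · rw [hx']; exact hg.hasMFDerivAt
    · exact ((contMDiffAt_extChartAt_symm hz).mdifferentiableAt (by simp)).hasMFDerivAt
  have hgd' := hasMFDerivAt_iff_hasFDerivAt.1 hgd
  have h1 : inChart (fun y => g y • α y) x = fun z => (g ∘ φ.symm) z • inChart α x z := by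
    ext z e; rfl
  have h2 := (hgd'.smul hd.hasFDerivAt).fderiv
  rw [h1]
  have h3 := congrArg (fun A : EuclideanSpace ℝ (Fin m) →L[ℝ] EuclideanSpace ℝ (Fin m) →L[ℝ] ℝ =>
    A (dChart x x u) e) h2
  refine h3.trans ?_
  have h5 : (show EuclideanSpace ℝ (Fin m) from dChartSymm x (φ x) (dChart x x u)) =
      (show EuclideanSpace ℝ (Fin m) from u) :=
    dChartSymm_dChart_apply (mem_extChartAt_source (I := 𝓡 m) x) u
  have h6 : ∀ (c d : ℝ) (A : EuclideanSpace ℝ (Fin m) →L[ℝ] EuclideanSpace ℝ (Fin m) →L[ℝ] ℝ)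
      (B : EuclideanSpace ℝ (Fin m) →L[ℝ] ℝ) (a : EuclideanSpace ℝ (Fin m) →L[ℝ] ℝ)
      (w : EuclideanSpace ℝ (Fin m)), (c • A + B.smulRight a) w e = c * A w e + B w * a e :=
    fun c d A B a w => by simp
  refine (h6 _ 0 _ _ _ _).trans ?_
  congr 1
  · simp only [Function.comp_apply, hx']
  · congr 1
    exact congrArg (mfderiv (𝓡 m) 𝓘(ℝ, ℝ) g x : EuclideanSpace ℝ (Fin m) →L[ℝ] ℝ) h5

theorem mfderiv_apply_eq {U : Set M} (hU : IsOpen U) {α : OneForm m M} (hα : SmoothFormOn U α)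
    {X : VField m M} (hX : SmoothVField X) {x : M} (hx : x ∈ U) (v : TangentSpace (𝓡 m) x) :
    dFun (fun y => α y (X y)) x v =
      fderiv ℝ (inChart α x) (extChartAt (𝓡 m) x x) (dChart x x v) (dChart x x (X x)) +
        inChart α x (extChartAt (𝓡 m) x x)
          (fderiv ℝ (chartField x X) (extChartAt (𝓡 m) x x) (dChart x x v)) := by
  set φ := extChartAt (𝓡 m) x with hφ
  have hz : φ x ∈ φ.target := mem_extChartAt_target x
  have hd : DifferentiableAt ℝ (inChart α x) (φ x) :=
    (contDiffAt_inChart hU hα hx).differentiableAt (by simp)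
  have hXd : DifferentiableAt ℝ (chartField x X) (φ x) :=
    ((contDiffOn_chartField x hX).contDiffAt
      ((isOpen_extChartAt_target x).mem_nhds hz)).differentiableAt (by simp)
  have h1 := hasMFDerivAt_iff_hasFDerivAt.2 (hd.hasFDerivAt.clm_apply hXd.hasFDerivAt)
  have h2 : HasMFDerivAt (𝓡 m) 𝓘(ℝ, EuclideanSpace ℝ (Fin m)) φ x (dChart x x) :=
    (mdifferentiableAt_extChartAt (mem_chart_source _ x)).hasMFDerivAt
  have h3 := h1.comp x h2
  have h4 : (fun y => α y (X y)) =ᶠ[𝓝 x]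
      (fun z => inChart α x z (chartField x X z)) ∘ φ := by
    filter_upwards [extChartAt_source_mem_nhds (I := 𝓡 m) x] with y hy
    rw [Function.comp_apply, inChart_chartField α X (φ.map_source hy), φ.left_inv hy]
  have h5 := (h3.congr_of_eventuallyEq h4).mfderiv
  have h6 := congrArg (fun A : EuclideanSpace ℝ (Fin m) →L[ℝ] ℝ => A v) h5
  refine h6.trans ?_
  have h7 := chartField_apply X (mem_extChartAt_source (I := 𝓡 m) x)
  rw [← h7]
  exact add_comm _ _

/-- The term `(∂_v α)(X)` of `dα` cancels against the same term of `d(α(X))`. -/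
theorem lieD_eq {U : Set M} (hU : IsOpen U) {α : OneForm m M} (hα : SmoothFormOn U α)
    {X : VField m M} (hX : SmoothVField X) {x : M} (hx : x ∈ U) (v : TangentSpace (𝓡 m) x) :
    lieD X α x v =
      fderiv ℝ (inChart α x) (extChartAt (𝓡 m) x x) (dChart x x (X x)) (dChart x x v) +
        inChart α x (extChartAt (𝓡 m) x x)
          (fderiv ℝ (chartField x X) (extChartAt (𝓡 m) x x) (dChart x x v)) := by
  have h1 : lieD X α x v = fderiv ℝ (inChart α x) (extChartAt (𝓡 m) x x) (dChart x x (X x))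
      (dChart x x v) - fderiv ℝ (inChart α x) (extChartAt (𝓡 m) x x) (dChart x x v)
      (dChart x x (X x)) + dFun (fun y => α y (X y)) x v := rfl
  rw [h1, mfderiv_apply_eq hU hα hX hx]
  ring

/-- If `X` and `Y` commute then `(L_Y α)(X) = Y (α(X))`. -/
theorem lieD_apply_of_commute {U : Set M} (hU : IsOpen U) {α : OneForm m M}
    (hα : SmoothFormOn U α) {X Y : VField m M} (hX : SmoothVField X) (hY : SmoothVField Y)
    (h : VectorField.mlieBracket (𝓡 m) X Y = 0) {x : M} (hx : x ∈ U) :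
    lieD Y α x (X x) = dFun (fun y => α y (X y)) x (Y x) := by
  rw [lieD_eq hU hα hY hx, mfderiv_apply_eq hU hα hX hx]
  have h1 := fderiv_chartField_comm hX hY h (mem_extChartAt_target (I := 𝓡 m) x)
  rw [chartField_apply X (mem_extChartAt_source (I := 𝓡 m) x),
    chartField_apply Y (mem_extChartAt_source (I := 𝓡 m) x)] at h1
  rw [h1]

theorem extD_smul {U : Set M} (hU : IsOpen U) {α : OneForm m M} (hα : SmoothFormOn U α)
    {g : M → ℝ} {x : M} (hx : x ∈ U) (hg : MDifferentiableAt (𝓡 m) 𝓘(ℝ, ℝ) g x)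
    (u v : TangentSpace (𝓡 m) x) : extD (fun y => g y • α y) x u v =
      g x * extD α x u v + dFun g x u * α x v - dFun g x v * α x u := by
  have h1 : ∀ β : OneForm m M, extD β x u v =
      fderiv ℝ (inChart β x) (extChartAt (𝓡 m) x x) (dChart x x u) (dChart x x v) -
      fderiv ℝ (inChart β x) (extChartAt (𝓡 m) x x) (dChart x x v) (dChart x x u) := fun _ => rfl
  rw [h1, h1, fderiv_inChart_smul hU hα hx hg, fderiv_inChart_smul hU hα hx hg, inChart_dChart,
    inChart_dChart]
  ring

theorem lieD_smul {U : Set M} (hU : IsOpen U) {α : OneForm m M} (hα : SmoothFormOn U α)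
    {g : M → ℝ} (hg : ContMDiffOn (𝓡 m) 𝓘(ℝ, ℝ) ∞ g U) {X : VField m M} (hX : SmoothVField X)
    {x : M} (hx : x ∈ U) (v : TangentSpace (𝓡 m) x) :
    lieD X (fun y => g y • α y) x v = g x * lieD X α x v + dFun g x (X x) * α x v := by
  have h1 : ∀ e, inChart (fun y => g y • α y) x (extChartAt (𝓡 m) x x) e =
      g x * inChart α x (extChartAt (𝓡 m) x x) e := fun e => by
    have : g x = g ((extChartAt (𝓡 m) x).symm (extChartAt (𝓡 m) x x)) := by
      rw [extChartAt_to_inv]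
    rw [this]
    rfl
  rw [lieD_eq hU (hα.smul hg) hX hx, lieD_eq hU hα hX hx, fderiv_inChart_smul hU hα hx
    ((hg.contMDiffAt (hU.mem_nhds hx)).mdifferentiableAt (by simp)), inChart_dChart, h1]
  ring

variable {ξ : Distribution m M}

theorem Represents.mono {U V : Set M} {α : OneForm m M} (hα : Represents ξ U α) (hV : IsOpen V)
    (h : V ⊆ U) : Represents ξ V α where
  contact :=
    { isOpen := hV
      smooth := hα.contact.smooth.mono h
      ne_zero := fun x hx => hα.contact.ne_zero x (h hx)
      nondegenerate := fun x hx => hα.contact.nondegenerate x (h hx) }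
  mem_iff x hx := hα.mem_iff x (h hx)

/-- On `ker α` one has `d(g α) = g dα`, so nondegeneracy survives rescaling. -/
theorem Represents.smul {U : Set M} {α : OneForm m M} (hα : Represents ξ U α) {g : M → ℝ}
    (hg : ContMDiffOn (𝓡 m) 𝓘(ℝ, ℝ) ∞ g U) (h0 : ∀ x ∈ U, g x ≠ 0) :
    Represents ξ U fun y => g y • α y where
  contact :=
    { isOpen := hα.contact.isOpen
      smooth := hα.contact.smooth.smul hg
      ne_zero := fun x hx => smul_ne_zero (h0 x hx) (hα.contact.ne_zero x hx)
      nondegenerate := fun x hx u hu huv => by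
        have h1 : ∀ v, (g x • α x) v = g x * α x v := fun v => rfl
        have hker : ∀ v, (g x • α x) v = 0 ↔ α x v = 0 := fun v => by
          rw [h1, mul_eq_zero, or_iff_right (h0 x hx)]
        refine hα.contact.nondegenerate x hx u ((hker u).1 hu) fun v hv => ?_
        have h2 := huv v ((hker v).2 hv)
        rw [extD_smul hα.contact.isOpen hα.contact.smooth hx
          ((hg.contMDiffAt (hα.contact.isOpen.mem_nhds hx)).mdifferentiableAt (by simp)), hv,
          (hker u).1 hu] at h2
        simpa [h0 x hx] using h2 }
  mem_iff x hx v := by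
    have h1 : (g x • α x) v = g x * α x v := rfl
    rw [hα.mem_iff x hx, h1, mul_eq_zero, or_iff_right (h0 x hx)]

theorem represents_univ_of_locally {α : OneForm m M}
    (h : ∀ x, ∃ U, x ∈ U ∧ ∃ β, Represents ξ U β ∧ ∀ y ∈ U, α y = β y) :
    Represents ξ univ α := by
  have h' : ∀ x, ∃ U, x ∈ U ∧ ∃ β, Represents ξ U β ∧ α x = β x ∧ ∀ᶠ y in 𝓝 x, α y = β y := by
    intro x
    obtain ⟨U, hx, β, hβ, he⟩ := h x
    exact ⟨U, hx, β, hβ, he x hx,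
      Filter.eventually_of_mem (hβ.contact.isOpen.mem_nhds hx) he⟩
  refine ⟨⟨isOpen_univ, ?_, ?_, ?_⟩, ?_⟩
  · refine ContMDiff.contMDiffOn fun x => ?_
    obtain ⟨U, hx, β, hβ, -, he⟩ := h' x
    refine (hβ.contact.smooth.contMDiffAt (hβ.contact.isOpen.mem_nhds hx)).congr_of_eventuallyEq ?_
    filter_upwards [he] with y hy
    rw [hy]
  · intro x _
    obtain ⟨U, hx, β, hβ, he, -⟩ := h' x
    exact he ▸ hβ.contact.ne_zero x hx
  · intro x _ u
    obtain ⟨U, hx, β, hβ, he, he'⟩ := h' x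
    simp only [extD_congr he', he]
    exact hβ.contact.nondegenerate x hx u
  · intro x _
    obtain ⟨U, hx, β, hβ, he, -⟩ := h' x
    exact he ▸ hβ.mem_iff x hx

/-- Normalising a contact form on a transversal infinitesimal automorphism `X` makes it invariant
under all infinitesimal automorphisms that commute with `X`. -/
theorem Represents.normalize {U : Set M} {α : OneForm m M} (hα : Represents ξ U α)
    {X : VField m M} (hX : SmoothVField X) (h0 : ∀ y ∈ U, α y (X y) ≠ 0) :
    Represents ξ U (fun y => (α y (X y))⁻¹ • α y) ∧
      ∀ Y, IsContactVField ξ Y → VectorField.mlieBracket (𝓡 m) X Y = 0 →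
        ∀ x ∈ U, ∀ v, lieD Y (fun y => (α y (X y))⁻¹ • α y) x v = 0 := by
  have hU := hα.contact.isOpen
  have hβ := hα.smul (g := fun y => (α y (X y))⁻¹)
    (ContMDiffOn.inv₀ (contMDiffOn_apply hα.contact.smooth hX) h0)
    fun x hx => inv_ne_zero (h0 x hx)
  refine ⟨hβ, fun Y hY hXY x hx v => ?_⟩
  set β : OneForm m M := fun y => (α y (X y))⁻¹ • α y with hβdef
  have h1 : ∀ y ∈ U, β y (X y) = 1 := fun y hy => inv_mul_cancel₀ (h0 y hy)
  obtain ⟨c, -, hc⟩ := hY.lie_eq U β hβ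
  have h2 : (fun y => β y (X y)) =ᶠ[𝓝 x] fun _ => 1 :=
    Filter.eventually_of_mem (hU.mem_nhds hx) h1
  -- Evaluating `L_Y β = c β` on `X`: the left side is the derivative of the constant `β(X) = 1`,
  -- the right side is `c`.
  have h3 := hc x hx (X x)
  rw [lieD_apply_of_commute hU hβ.contact.smooth hX hY.smooth hXY hx, h1 x hx, mul_one, dFun,
    h2.mfderiv_eq, mfderiv_const] at h3
  have h4 : c x = 0 := h3.symm
  rw [hc x hx, h4, zero_mul]

end PfaffianForms

/-! ### First integrals of `𝒳`. -/

section FirstIntegrals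

variable {m : ℕ} {M : Type*} [TopologicalSpace M] [ChartedSpace (EuclideanSpace ℝ (Fin m)) M]

/-- `g` is smooth at `x` and its derivative along all elements of `𝒳` vanishes there. -/
structure IsFirstIntegralAt (𝒳 : Submodule ℝ (VField m M)) (g : M → ℝ) (x : M) : Prop where
  smooth : ContMDiffAt (𝓡 m) 𝓘(ℝ, ℝ) ∞ g x
  dFun_eq : ∀ Y ∈ 𝒳, dFun g x (Y x) = 0

namespace IsFirstIntegralAt

variable {𝒳 : Submodule ℝ (VField m M)} {f g : M → ℝ} {x : M}

theorem hasMFDerivAt (hf : IsFirstIntegralAt 𝒳 f x) :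
    HasMFDerivAt (𝓡 m) 𝓘(ℝ, ℝ) f x (dFun f x) :=
  (hf.smooth.mdifferentiableAt (by simp)).hasMFDerivAt

theorem congr (hf : IsFirstIntegralAt 𝒳 f x) (h : g =ᶠ[𝓝 x] f) : IsFirstIntegralAt 𝒳 g x where
  smooth := hf.smooth.congr_of_eventuallyEq h
  dFun_eq Y hY := by
    have h1 : dFun (m := m) g x = dFun f x := h.mfderiv_eq
    rw [h1, hf.dFun_eq Y hY]

theorem const (c : ℝ) : IsFirstIntegralAt 𝒳 (fun _ => c) x where
  smooth := contMDiffAt_const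
  dFun_eq Y _ := by
    have h1 : dFun (m := m) (fun _ : M => c) x = 0 := mfderiv_const
    rw [h1]
    rfl

theorem add (hf : IsFirstIntegralAt 𝒳 f x) (hg : IsFirstIntegralAt 𝒳 g x) :
    IsFirstIntegralAt 𝒳 (fun y => f y + g y) x where
  smooth := hf.smooth.add hg.smooth
  dFun_eq Y hY := by
    have h1 : dFun (m := m) (fun y => f y + g y) x = dFun f x + dFun g x :=
      (hf.hasMFDerivAt.add hg.hasMFDerivAt).mfderiv
    have h2 : ∀ A B : TangentSpace (𝓡 m) x →L[ℝ] ℝ, (A + B) (Y x) = A (Y x) + B (Y x) :=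
      fun _ _ => rfl
    rw [h1, h2, hf.dFun_eq Y hY, hg.dFun_eq Y hY, add_zero]

theorem mul (hf : IsFirstIntegralAt 𝒳 f x) (hg : IsFirstIntegralAt 𝒳 g x) :
    IsFirstIntegralAt 𝒳 (fun y => f y * g y) x where
  smooth := hf.smooth.mul hg.smooth
  dFun_eq Y hY := by
    have h1 : dFun (m := m) (fun y => f y * g y) x = f x • dFun g x + g x • dFun f x :=
      (hf.hasMFDerivAt.mul hg.hasMFDerivAt).mfderiv
    have h2 : ∀ (a b : ℝ) (A B : TangentSpace (𝓡 m) x →L[ℝ] ℝ),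
        (a • A + b • B) (Y x) = a * A (Y x) + b * B (Y x) := fun _ _ _ _ => rfl
    rw [h1, h2, hf.dFun_eq Y hY, hg.dFun_eq Y hY, mul_zero, mul_zero, add_zero]

theorem sum {ι : Type*} {s : Finset ι} {f : ι → M → ℝ}
    (hf : ∀ i ∈ s, IsFirstIntegralAt 𝒳 (f i) x) :
    IsFirstIntegralAt 𝒳 (fun y => ∑ i ∈ s, f i y) x := by
  classical
  induction s using Finset.induction_on with
  | empty => simpa using const 0
  | insert a s ha ih =>
    simp only [Finset.sum_insert ha]
    exact (hf a (Finset.mem_insert_self a s)).add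
      (ih fun i hi => hf i (Finset.mem_insert_of_mem hi))

theorem comp (hf : IsFirstIntegralAt 𝒳 f x) {φ : ℝ → ℝ} (hφ : ContDiffAt ℝ ∞ φ (f x)) :
    IsFirstIntegralAt 𝒳 (fun y => φ (f y)) x where
  smooth := hφ.contMDiffAt.comp x hf.smooth
  dFun_eq Y hY := by
    have h1 : HasMFDerivAt 𝓘(ℝ, ℝ) 𝓘(ℝ, ℝ) φ (f x) (fderiv ℝ φ (f x)) :=
      hasMFDerivAt_iff_hasFDerivAt.2 (hφ.differentiableAt (by simp)).hasFDerivAt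
    have h2 : dFun (m := m) (fun y => φ (f y)) x = (fderiv ℝ φ (f x)).comp (dFun f x) :=
      (h1.comp x hf.hasMFDerivAt).mfderiv
    have h3 : ((fderiv ℝ φ (f x)).comp (dFun f x)) (Y x) = fderiv ℝ φ (f x) (dFun f x (Y x)) := rfl
    rw [h2, h3, hf.dFun_eq Y hY, map_zero]

/-- This makes the partition functions pulled back from `W` harmless. -/
theorem comp_map {p : ℕ} {W : Type*} [TopologicalSpace W]
    [ChartedSpace (EuclideanSpace ℝ (Fin p)) W] {π : M → W}
    (hπ : ContMDiffAt (𝓡 m) (𝓡 p) ∞ π x) (hv : ∀ Y ∈ 𝒳, Y x ∈ vertical (p := p) π x)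
    {ρ : W → ℝ} (hρ : ContMDiffAt (𝓡 p) 𝓘(ℝ, ℝ) ∞ ρ (π x)) :
    IsFirstIntegralAt 𝒳 (fun y => ρ (π y)) x where
  smooth := hρ.comp x hπ
  dFun_eq Y hY := by
    have h1 := ((hρ.mdifferentiableAt (by simp)).hasMFDerivAt.comp x
      (hπ.mdifferentiableAt (by simp)).hasMFDerivAt).mfderiv
    have h2 : dFun (fun y => ρ (π y)) x (Y x) =
        dFun ρ (π x) (mfderiv (𝓡 m) (𝓡 p) π x (Y x)) := DFunLike.congr_fun h1 (Y x)
    have h3 : mfderiv (𝓡 m) (𝓡 p) π x (Y x) = 0 := hv Y hY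
    rw [h2, h3, map_zero]

end IsFirstIntegralAt

end FirstIntegrals

/-- Two functionals with the same positive side are positive multiples of each other. -/
theorem exists_pos_smul_eq {E : Type*} [AddCommGroup E] [Module ℝ E] [TopologicalSpace E]
    {f g : E →L[ℝ] ℝ} (hf : f ≠ 0) (h : {v | 0 < f v} = {v | 0 < g v}) :
    ∃ c : ℝ, 0 < c ∧ g = c • f := by
  have h' : ∀ v, 0 < f v ↔ 0 < g v := fun v => Set.ext_iff.1 h v
  obtain ⟨u, hu⟩ : ∃ u, 0 < f u := by
    obtain ⟨v, hv⟩ := DFunLike.ne_iff.1 hf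
    rcases lt_or_gt_of_ne hv with hv | hv
    · exact ⟨-v, by rw [map_neg]; simpa using hv⟩
    · exact ⟨v, by simpa using hv⟩
  refine ⟨g u / f u, div_pos ((h' u).1 hu) hu, ContinuousLinearMap.ext fun v => ?_⟩
  have h1 : f (v - (f v / f u) • u) = 0 := by
    rw [map_sub, map_smul, smul_eq_mul, div_mul_cancel₀ _ hu.ne', sub_self]
  -- On `ker f` neither a vector nor its negative is positive for `f`, hence neither is for `g`.
  have h2 : g (v - (f v / f u) • u) = 0 := by
    set w := v - (f v / f u) • u
    have h3 := (h' w).not.1 (by rw [h1]; exact lt_irrefl 0)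
    have h4 := (h' (-w)).not.1 (by rw [map_neg, h1, neg_zero]; exact lt_irrefl 0)
    rw [map_neg] at h4
    linarith
  rw [map_sub, map_smul, smul_eq_mul, sub_eq_zero] at h2
  rw [h2, smul_apply, smul_eq_mul]
  ring

/-! ### Gluing the local invariant forms. -/

namespace IsCompletePreIsotropic

variable {n p : ℕ}
    {M : Type*} [TopologicalSpace M]
    [ChartedSpace (EuclideanSpace ℝ (Fin (2 * n + 1))) M] [IsManifold (𝓡 (2 * n + 1)) ∞ M]
    {W : Type*} [TopologicalSpace W]
    [ChartedSpace (EuclideanSpace ℝ (Fin p)) W]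
    {ξ : Distribution (2 * n + 1) M} {𝒳 : Submodule ℝ (VField (2 * n + 1) M)} {π : M → W}

theorem isOpen_apply_notMem (h : IsCompletePreIsotropic (p := p) ξ 𝒳 π)
    {X : VField (2 * n + 1) M} (hX : SmoothVField X) : IsOpen {y | X y ∉ ξ y} := by
  refine isOpen_iff_mem_nhds.2 fun y hy => ?_
  obtain ⟨U, hyU, α, hα⟩ := h.contact y
  have hV : IsOpen (U ∩ (fun y => α y (X y)) ⁻¹' {0}ᶜ) :=
    (contMDiffOn_apply hα.contact.smooth hX).continuousOn.isOpen_inter_preimage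
      hα.contact.isOpen isOpen_compl_singleton
  refine Filter.mem_of_superset (hV.mem_nhds ⟨hyU, fun h0 => hy ?_⟩) fun z hz hzξ => hz.2 ?_
  · exact (hα.mem_iff y hyU _).2 h0
  · exact (hα.mem_iff z hz.1 _).1 hzξ

variable [T2Space M]

/-- Near every point, there is a positive contact form that is invariant under `𝒳`. -/
theorem exists_invariant_form (h : IsCompletePreIsotropic (p := p) ξ 𝒳 π)
    {P : (x : M) → Set (TangentSpace (𝓡 (2 * n + 1)) x)} (hP : IsCoorientation ξ P) (x : M) :
    ∃ U : Set M, x ∈ U ∧ ∃ β : OneForm (2 * n + 1) M, Represents ξ U β ∧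
      (∀ y ∈ U, P y = {v | 0 < β y v}) ∧
      ∀ Y ∈ 𝒳, ∀ y ∈ U, ∀ v, lieD Y β y v = 0 := by
  obtain ⟨U, hx, α, hα, hPα⟩ := hP x
  -- The sign of `X` is chosen so that dividing by `α(X)` respects the co-orientation.
  obtain ⟨X, hX, hpos⟩ : ∃ X ∈ 𝒳, 0 < α x (X x) := by
    obtain ⟨X, hX, hXξ⟩ := h.exists_apply_notMem x
    rw [hα.mem_iff x hx] at hXξ
    rcases lt_or_gt_of_ne hXξ with h1 | h1
    · refine ⟨-X, 𝒳.neg_mem hX, ?_⟩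
      have h2 : α x ((-X) x) = -α x (X x) := map_neg (α x) (X x)
      rw [h2]
      exact neg_pos.2 h1
    · exact ⟨X, hX, h1⟩
  have hXs := (h.contact_vfield X hX).smooth
  have hV : IsOpen (U ∩ (fun y => α y (X y)) ⁻¹' Ioi 0) :=
    (contMDiffOn_apply hα.contact.smooth hXs).continuousOn.isOpen_inter_preimage
      hα.contact.isOpen isOpen_Ioi
  obtain ⟨h1, h2⟩ := (hα.mono hV inter_subset_left).normalize hXs fun y hy => (ne_of_gt hy.2)
  have hxV : x ∈ U ∩ (fun y => α y (X y)) ⁻¹' Ioi 0 := ⟨hx, hpos⟩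
  refine ⟨_, hxV, _, h1, fun y hy => ?_, fun Y hY => h2 Y (h.contact_vfield Y hY)
    (h.abelian X hX Y hY)⟩
  rw [hPα y hy.1]
  ext v
  have hy2 : 0 < α y (X y) := hy.2
  exact (mul_pos_iff_of_pos_left (inv_pos.2 hy2)).symm

/-- Compactness of the fiber over `w` gives a finite set of fields; since `π` is closed, the open
set they control contains the preimage of a neighbourhood of `w`. -/
theorem exists_finset_forall_exists_notMem (h : IsCompletePreIsotropic (p := p) ξ 𝒳 π) (w : W) :
    ∃ (I : Finset 𝒳) (V : Set W), IsOpen V ∧ w ∈ V ∧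
      ∀ y, π y ∈ V → ∃ X ∈ I, (X : VField (2 * n + 1) M) y ∉ ξ y := by
  have hO : ∀ X : 𝒳, IsOpen {y | (X : VField (2 * n + 1) M) y ∉ ξ y} := fun X =>
    h.isOpen_apply_notMem (h.contact_vfield X X.2).smooth
  obtain ⟨I, hI⟩ := (h.proper.isCompact_preimage (isCompact_singleton (x := w))).elim_finite_subcover
    _ hO fun y _ => by
      obtain ⟨X, hX, hy⟩ := h.exists_apply_notMem y
      exact mem_iUnion.2 ⟨⟨X, hX⟩, hy⟩
  set O := ⋃ X ∈ I, {y | (X : VField (2 * n + 1) M) y ∉ ξ y} with hOdef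
  have hOo : IsOpen O := isOpen_biUnion fun X _ => hO X
  refine ⟨I, (π '' Oᶜ)ᶜ, (h.proper.isClosedMap _ hOo.isClosed_compl).isOpen_compl, ?_, ?_⟩
  · rintro ⟨y, hy, rfl⟩
    exact hy (hI rfl)
  · intro y hy
    have h1 : y ∈ O := by_contra fun h2 => hy ⟨y, h2, rfl⟩
    simpa [O] using h1

/-- If `𝓗` is co-oriented, there is a global contact form invariant under `𝒳`. -/
theorem exists_invariant_contactForm (h : IsCompletePreIsotropic (p := p) ξ 𝒳 π) [T2Space W]
    [SecondCountableTopology W] [IsManifold (𝓡 p) ∞ W]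
    {P : (x : M) → Set (TangentSpace (𝓡 (2 * n + 1)) x)} (hP : IsCoorientation ξ P) :
    ∃ α : OneForm (2 * n + 1) M, Represents ξ univ α ∧ ∀ X ∈ 𝒳, ∀ x v, lieD X α x v = 0 := by
  have := Manifold.locallyCompact_of_finiteDimensional (M := W) (𝓡 p)
  choose I V hVo hwV hV using h.exists_finset_forall_exists_notMem
  obtain ⟨ρ, hρ⟩ := SmoothPartitionOfUnity.exists_isSubordinate (𝓡 p) isClosed_univ V hVo
    fun w _ => mem_iUnion.2 ⟨w, hwV w⟩
  choose U hxU β hβ hPβ hinv using h.exists_invariant_form hP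
  -- Squares make the sum over `w` and `X` positive on every nonzero covector vanishing on `ξ`,
  -- whatever the signs of the individual `f (X x)`.
  let S (w : W) (x : M) (f : TangentSpace (𝓡 (2 * n + 1)) x →L[ℝ] ℝ) : ℝ :=
    ρ w (π x) * ∑ X ∈ I w, f ((X : VField (2 * n + 1) M) x) * f ((X : VField (2 * n + 1) M) x)
  let Q (x : M) (f : TangentSpace (𝓡 (2 * n + 1)) x →L[ℝ] ℝ) : ℝ := ∑ᶠ w, S w x f
  have hQsmul : ∀ x f (c : ℝ), Q x (c • f) = c ^ 2 * Q x f := by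
    intro x f c
    simp only [Q]
    rw [mul_finsum]
    refine finsum_congr fun w => ?_
    have h1 : ∀ v, (c • f) v * (c • f) v = c ^ 2 * (f v * f v) := fun v => by
      have : (c • f) v = c * f v := rfl
      rw [this]; ring
    simp only [S, h1, ← Finset.mul_sum]
    ring
  have hQpos : ∀ x, ∀ y ∈ U x, 0 < Q y (β x y) := by
    intro x y hy
    have h0 : ∀ w, 0 ≤ S w y (β x y) := fun w =>
      mul_nonneg (ρ.nonneg w _) (Finset.sum_nonneg fun X _ => mul_self_nonneg _)
    obtain ⟨w, hw⟩ := ρ.exists_pos_of_mem (mem_univ (π y))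
    have hyV : π y ∈ V w := hρ w (subset_tsupport _ (Function.mem_support.2 hw.ne'))
    obtain ⟨X, hX, hXy⟩ := hV w y hyV
    rw [(hβ x).mem_iff y hy] at hXy
    refine finsum_pos h0 ⟨w, mul_pos hw ?_⟩ ((ρ.locallyFinite.point_finite (π y)).subset ?_)
    · exact Finset.sum_pos' (fun X _ => mul_self_nonneg _) ⟨X, hX, mul_self_pos.2 hXy⟩
    · exact fun w hw => left_ne_zero_of_mul hw
  -- For the invariant form `β x`, each `β x (X)` has derivative `(L_Y (β x))(X) = 0` along `Y ∈ 𝒳`;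
  -- local finiteness reduces the sum to finitely many `w`.
  have hQint : ∀ x, ∀ y ∈ U x, IsFirstIntegralAt 𝒳 (fun z => Q z (β x z)) y := by
    intro x y hy
    have hβo := (hβ x).contact.isOpen
    have hπ : ContMDiffAt (𝓡 (2 * n + 1)) (𝓡 p) ∞ π y :=
      (h.submersion.isSubmersionAt y).contMDiffAt
    obtain ⟨N, hN, hfin⟩ := ρ.locallyFinite (π y)
    have hS : ∀ w, IsFirstIntegralAt 𝒳 (fun z => S w z (β x z)) y := by
      intro w
      refine (IsFirstIntegralAt.comp_map hπ (fun Y hY => h.apply_mem_vertical hY y)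
        ((ρ w).contMDiff _)).mul (IsFirstIntegralAt.sum fun X _ => ?_)
      have h1 : IsFirstIntegralAt 𝒳 (fun z => β x z ((X : VField (2 * n + 1) M) z)) y :=
        { smooth := (contMDiffOn_apply (hβ x).contact.smooth
            (h.contact_vfield X X.2).smooth).contMDiffAt (hβo.mem_nhds hy)
          dFun_eq := fun Y hY => by
            rw [← lieD_apply_of_commute hβo (hβ x).contact.smooth (h.contact_vfield X X.2).smooth
              (h.contact_vfield Y hY).smooth (h.abelian X X.2 Y hY) hy]
            exact hinv x Y hY y hy _ }
      exact h1.mul h1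
    refine (IsFirstIntegralAt.sum (s := hfin.toFinset) fun w _ => hS w).congr ?_
    filter_upwards [hπ.continuousAt hN] with z hz
    refine finsum_eq_sum_of_support_subset _ fun w hw => ?_
    exact hfin.mem_toFinset.2 ⟨π z, left_ne_zero_of_mul hw, hz⟩
  have hg : ∀ x, ∀ y ∈ U x, IsFirstIntegralAt 𝒳 (fun z => (√(Q z (β x z)))⁻¹) y := fun x y hy =>
    (hQint x y hy).comp (φ := fun r => (√r)⁻¹) ((contDiffAt_id.sqrt (hQpos x y hy).ne').inv
      (Real.sqrt_pos.2 (hQpos x y hy)).ne')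
  have hgs : ∀ x, ContMDiffOn (𝓡 (2 * n + 1)) 𝓘(ℝ, ℝ) ∞ (fun z => (√(Q z (β x z)))⁻¹) (U x) :=
    fun x y hy => (hg x y hy).smooth.contMDiffWithinAt
  -- A different local form is used at every point; smoothness comes from the independence shown
  -- next, where the factor `c > 0` cancels against `√(c ^ 2)`.
  let α : OneForm (2 * n + 1) M := fun x => (√(Q x (β x x)))⁻¹ • β x x
  have hα : ∀ x, ∀ y ∈ U x, α y = (√(Q y (β x y)))⁻¹ • β x y := by
    intro x y hy
    obtain ⟨c, hc, hcβ⟩ := exists_pos_smul_eq ((hβ x).contact.ne_zero y hy)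
      ((hPβ x y hy).symm.trans (hPβ y y (hxU y)))
    simp only [α]
    rw [hcβ, hQsmul, Real.sqrt_mul (sq_nonneg c), Real.sqrt_sq hc.le, smul_smul, mul_inv,
      mul_right_comm, inv_mul_cancel₀ hc.ne', one_mul]
  refine ⟨α, represents_univ_of_locally fun x => ⟨U x, hxU x, _, (hβ x).smul (hgs x)
    fun y hy => inv_ne_zero (Real.sqrt_pos.2 (hQpos x y hy)).ne', hα x⟩, fun X hX x v => ?_⟩
  have hUo := (hβ x).contact.isOpen
  rw [lieD_congr (Filter.eventually_of_mem (hUo.mem_nhds (hxU x)) (hα x)),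
    lieD_smul hUo (hβ x).contact.smooth (hgs x) (h.contact_vfield X hX).smooth (hxU x),
    hinv x X hX x (hxU x), (hg x x (hxU x)).dFun_eq X hX, mul_zero, zero_mul, add_zero]

end IsCompletePreIsotropic

end PreIsotropic

end

theorem proposition1 {n p : ℕ}
    {M : Type*} [TopologicalSpace M] [T2Space M] [SecondCountableTopology M] [ConnectedSpace M]
    [ChartedSpace (EuclideanSpace ℝ (Fin (2 * n + 1))) M] [IsManifold (𝓡 (2 * n + 1)) ∞ M]
    {W : Type*} [TopologicalSpace W] [T2Space W] [SecondCountableTopology W]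
    [ChartedSpace (EuclideanSpace ℝ (Fin p)) W] [IsManifold (𝓡 p) ∞ W]
    (ξ : PreIsotropic.Distribution (2 * n + 1) M)
    (𝒳 : Submodule ℝ (PreIsotropic.VField (2 * n + 1) M))
    (π : M → W)
    (h : PreIsotropic.IsCompletePreIsotropic (p := p) ξ 𝒳 π)
    (hco : ∃ P : (x : M) → Set (TangentSpace (𝓡 (2 * n + 1)) x),
      PreIsotropic.IsCoorientation ξ P) :
    ∃ α : PreIsotropic.OneForm (2 * n + 1) M,
      PreIsotropic.Represents ξ univ α ∧
      ∀ X ∈ 𝒳, ∀ (x : M) (v : TangentSpace (𝓡 (2 * n + 1)) x), PreIsotropic.lieD X α x v = 0 := by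
  obtain ⟨P, hP⟩ := hco
  exact h.exists_invariant_contactForm hP
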